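/- Let $\Omega$ be an open set in $\mathbb R^N$ and let $m\ge 1$ be an integer. Let $W^{m,2}(\Omega)$ be the space of real-valued functions in $L^2(\Omega)$ with weak derivatives up to order $m$ in $L^2(\Omega)$, endowed with the norm $$\|u\|_{W^{m,2}(\Omega)}=\Big(\|u\|_{L^2(\Omega)}^2+\sum_{|\alpha|=m}\|D^\alpha u\|_{L^2(\Omega)}^2\Big)^{1/2}.$$ Let $A_{\alpha\beta}\in L^\infty(\Omega)$ be real-valued with $A_{\alpha\beta}=A_{\beta\alpha}$ for all multi-indices $\alpha,\beta\in\mathbb N_0^N$ with $|\alpha|,|\beta|\le m$, and put $$\mathcal Q[u,\varphi]=\int_\Omega\sum_{|\alpha|,|\beta|\le m}A_{\alpha\beta}\,D^\alpha u\,D^\beta\varphi\,dx .$$ Let $V(\Omega)$ be a closed subspace of $W^{m,2}(\Omega)$ such that the embedding $V(\Omega)\subset L^2(\Omega)$ is compact. Let $\mathcal R$ be the set of those $\rho\in L^\infty(\Omega)$ with $\operatorname{ess\,inf}_\Omega\rho>0$, and let $C\subset\mathcal R$ be bounded in $L^\infty(\Omega)$. Assume that there are constants $a,b,c>0$ such that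 $$a\|u\|_{W^{m,2}(\Omega)}^2\le \mathcal Q[u,u]+b\int_\Omega u^2\rho\,dx\qquad\text{and}\qquad \mathcal Q[u,u]\le c\,\|u\|_{W^{m,2}(\Omega)}^2$$ for all $u\in V(\Omega)$ and all $\rho\in C$. For $\rho\in C$ and every integer $n\ge 1$ with $n\le\dim V(\Omega)$ (that is, every $n\ge1$ if $V(\Omega)$ is infinite-dimensional) let $$\lambda_n[\rho]=\inf_{\substack{E\subset V(\Omega)\\ \dim E=n}}\ \sup_{\substack{u\in E\\ u\ne0}}\ \frac{\mathcal Q[u,u]}{\int_\Omega u^2\rho\,dx}.$$ Then, for every such $n$, the function $\rho\mapsto\lambda_n[\rho]$ from $C$ to $\mathbb R$ is continuous with respect to the weak* topology of $L^\infty(\Omega)=L^1(\Omega)'$. Moreover, if $V(\Omega)$ is complete in the norm of $W^{m,2}(\Omega)$ (for a closed $V(\Omega)$ this is automatic whenever $W^{m,2}(\Omega)$ with the norm above is complete), then for every $\rho\in C$ the numbers $\lambda_n[\rho]$, $1\le n\le\dim V(\Omega)$, are precisely the eigenvalues $\lambda\in\mathbb R$ of the problem $$\mathcal Q[u,\varphi]=\lambda\int_\Omega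 u\,\varphi\,\rho\,dx\quad\text{for all }\varphi\in V(\Omega),\qquad u\in V(\Omega),$$ listed in nondecreasing order, each repeated according to its multiplicity; all multiplicities are finite, and $\lambda_n[\rho]\to+\infty$ as $n\to\infty$ if $V(\Omega)$ is infinite-dimensional. -/

import Mathlib

open MeasureTheory Set Filter Topology TopologicalSpace
open scoped ENNReal ContDiff

noncomputable section

/-- Euclidean space `ℝ^N`. -/
abbrev Eucl (N : ℕ) : Type := EuclideanSpace ℝ (Fin N)

/-- Lebesgue measure on the open set `Ω`. -/
abbrev volOn {N : ℕ} (Ω : Opens (Eucl N)) : Measure (Eucl N) :=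
  (volume : Measure (Eucl N)).restrict (Ω : Set (Eucl N))

/-- Real `L^p(Ω)`. -/
abbrev LpOn {N : ℕ} (Ω : Opens (Eucl N)) (p : ℝ≥0∞) : Type := Lp ℝ p (volOn Ω)

/-! ### Multi-indices and classical derivatives of test functions -/

/-- The order `|α|` of a multi-index. -/
def miOrder {N : ℕ} (α : Fin N → ℕ) : ℕ := ∑ i, α i

/-- The finite set of the multi-indices of order at most `m`. -/
def miLE (N m : ℕ) : Finset (Fin N → ℕ) :=
  (Fintype.piFinset fun _ => Finset.range (m + 1)).filter fun α => miOrder α ≤ m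

/-- The finite set of the multi-indices of order exactly `m`. -/
def miEQ (N m : ℕ) : Finset (Fin N → ℕ) :=
  (miLE N m).filter fun α => miOrder α = m

theorem mem_miLE {N m : ℕ} {α : Fin N → ℕ} : α ∈ miLE N m ↔ miOrder α ≤ m := by
  simp only [miLE, Finset.mem_filter, Fintype.mem_piFinset, Finset.mem_range, and_iff_right_iff_imp]
  intro h i
  have : α i ≤ ∑ j, α j := Finset.single_le_sum (fun _ _ => Nat.zero_le _) (Finset.mem_univ i)
  exact Nat.lt_succ_of_le (this.trans h)

theorem mem_miEQ {N m : ℕ} {α : Fin N → ℕ} : α ∈ miEQ N m ↔ miOrder α = m := by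
  simp only [miEQ, Finset.mem_filter, mem_miLE, and_iff_right_iff_imp]
  exact fun h => h.le

/-- The classical partial derivative `∂φ/∂x_i`. -/
def partialDeriv {N : ℕ} (i : Fin N) (φ : Eucl N → ℝ) : Eucl N → ℝ :=
  fun x => fderiv ℝ φ x (EuclideanSpace.single i 1)

/-- The classical derivative `∂_1^{α_1} ⋯ ∂_N^{α_N} φ`. -/
def multiDeriv {N : ℕ} (α : Fin N → ℕ) (φ : Eucl N → ℝ) : Eucl N → ℝ :=
  (List.finRange N).foldr (fun i ψ => (partialDeriv i)^[α i] ψ) φ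

/-- `φ ∈ C_c^∞(Ω)`. -/
structure IsTestFun {N : ℕ} (Ω : Opens (Eucl N)) (φ : Eucl N → ℝ) : Prop where
  smooth : ContDiff ℝ ∞ φ
  compact : HasCompactSupport φ
  supp : tsupport φ ⊆ Ω

theorem IsTestFun.partialDeriv {N : ℕ} {Ω : Opens (Eucl N)} {φ : Eucl N → ℝ}
    (h : IsTestFun Ω φ) (i : Fin N) : IsTestFun Ω (partialDeriv i φ) where
  smooth := (h.smooth.fderiv_right (m := ∞) (by simp)).clm_apply contDiff_const
  compact := h.compact.fderiv_apply (𝕜 := ℝ) _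
  supp := (tsupport_fderiv_apply_subset ℝ _).trans h.supp

theorem IsTestFun.multiDeriv {N : ℕ} {Ω : Opens (Eucl N)} {φ : Eucl N → ℝ}
    (h : IsTestFun Ω φ) (α : Fin N → ℕ) : IsTestFun Ω (multiDeriv α φ) := by
  unfold _root_.multiDeriv
  induction List.finRange N with
  | nil => exact h
  | cons i l ih =>
    rw [List.foldr_cons]
    induction α i with
    | zero => exact ih
    | succ k ihk => rw [Function.iterate_succ_apply']; exact ihk.partialDeriv i

theorem IsTestFun.integrable_mul {N : ℕ} {Ω : Opens (Eucl N)} {φ : Eucl N → ℝ}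
    (h : IsTestFun Ω φ) (u : LpOn Ω 2) : Integrable (fun x => u x * φ x) (volOn Ω) :=
  MemLp.integrable_mul (p := 2) (q := 2) (Lp.memLp u)
    (h.smooth.continuous.memLp_of_hasCompactSupport h.compact)

/-! ### Weak derivatives and Sobolev spaces -/

/-- `v` is the weak derivative `D^α u` on `Ω`. -/
def HasWeakDeriv {N : ℕ} (Ω : Opens (Eucl N)) (α : Fin N → ℕ) (u v : LpOn Ω 2) : Prop :=
  ∀ φ : Eucl N → ℝ, IsTestFun Ω φ →
    ∫ x in (Ω : Set (Eucl N)), u x * multiDeriv α φ x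
      = (-1) ^ miOrder α * ∫ x in (Ω : Set (Eucl N)), v x * φ x

theorem HasWeakDeriv.add {N : ℕ} {Ω : Opens (Eucl N)} {α : Fin N → ℕ} {u v u' v' : LpOn Ω 2}
    (h : HasWeakDeriv Ω α u v) (h' : HasWeakDeriv Ω α u' v') :
    HasWeakDeriv Ω α (u + u') (v + v') := by
  intro φ hφ
  have e1 : (fun x => (u + u' : LpOn Ω 2) x * multiDeriv α φ x) =ᵐ[volOn Ω]
      fun x => u x * multiDeriv α φ x + u' x * multiDeriv α φ x := by
    filter_upwards [Lp.coeFn_add u u'] with x hx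
    rw [hx, Pi.add_apply, add_mul]
  have e2 : (fun x => (v + v' : LpOn Ω 2) x * φ x) =ᵐ[volOn Ω]
      fun x => v x * φ x + v' x * φ x := by
    filter_upwards [Lp.coeFn_add v v'] with x hx
    rw [hx, Pi.add_apply, add_mul]
  rw [integral_congr_ae e1, integral_congr_ae e2,
    integral_add ((hφ.multiDeriv α).integrable_mul u) ((hφ.multiDeriv α).integrable_mul u'),
    integral_add (hφ.integrable_mul v) (hφ.integrable_mul v'), h φ hφ, h' φ hφ, mul_add]

theorem HasWeakDeriv.smul {N : ℕ} {Ω : Opens (Eucl N)} {α : Fin N → ℕ} {u v : LpOn Ω 2}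
    (c : ℝ) (h : HasWeakDeriv Ω α u v) : HasWeakDeriv Ω α (c • u) (c • v) := by
  intro φ hφ
  have e1 : (fun x => (c • u : LpOn Ω 2) x * multiDeriv α φ x) =ᵐ[volOn Ω]
      fun x => c * (u x * multiDeriv α φ x) := by
    filter_upwards [Lp.coeFn_smul c u] with x hx
    rw [hx, Pi.smul_apply, smul_eq_mul, mul_assoc]
  have e2 : (fun x => (c • v : LpOn Ω 2) x * φ x) =ᵐ[volOn Ω] fun x => c * (v x * φ x) := by
    filter_upwards [Lp.coeFn_smul c v] with x hx
    rw [hx, Pi.smul_apply, smul_eq_mul, mul_assoc]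
  rw [integral_congr_ae e1, integral_congr_ae e2, integral_const_mul, integral_const_mul, h φ hφ]
  ring

theorem HasWeakDeriv.zero {N : ℕ} (Ω : Opens (Eucl N)) (α : Fin N → ℕ) :
    HasWeakDeriv Ω α 0 0 := by
  intro φ hφ
  have e (ψ : Eucl N → ℝ) : (fun x => (0 : LpOn Ω 2) x * ψ x) =ᵐ[volOn Ω] fun _ => 0 := by
    filter_upwards [Lp.coeFn_zero ℝ 2 (volOn Ω)] with x hx
    rw [hx]; simp
  rw [integral_congr_ae (e _), integral_congr_ae (e _)]
  simp

/-- Weak derivatives are unique. -/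
theorem HasWeakDeriv.unique {N : ℕ} {Ω : Opens (Eucl N)} {α : Fin N → ℕ} {u v w : LpOn Ω 2}
    (hv : HasWeakDeriv Ω α u v) (hw : HasWeakDeriv Ω α u w) : v = w := by
  have h0 : HasWeakDeriv Ω α (u + (-1 : ℝ) • u) (v + (-1 : ℝ) • w) := hv.add (hw.smul (-1))
  have hu : u + (-1 : ℝ) • u = 0 := by simp
  rw [hu] at h0
  set d : LpOn Ω 2 := v + (-1 : ℝ) • w with hd
  have hloc : LocallyIntegrableOn d (Ω : Set (Eucl N)) (volOn Ω) :=
    ((Lp.memLp d).locallyIntegrable (by norm_num)).locallyIntegrableOn _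
  have key := Ω.isOpen.ae_eq_zero_of_integral_contDiff_smul_eq_zero hloc (by
    intro g g1 g2 g3
    have hg : IsTestFun Ω g := ⟨g1, g2, g3⟩
    have e1 := h0 g hg
    have e2 := HasWeakDeriv.zero Ω α g hg
    rw [e2] at e1
    have z : ∫ x, (0 : LpOn Ω 2) x * g x ∂(volOn Ω) = 0 := by
      have : (fun x => (0 : LpOn Ω 2) x * g x) =ᵐ[volOn Ω] fun _ => 0 := by
        filter_upwards [Lp.coeFn_zero ℝ 2 (volOn Ω)] with x hx
        rw [hx]; simp
      rw [integral_congr_ae this]; simp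
    rw [z, mul_zero] at e1
    have e3 : ∫ x, d x * g x ∂(volOn Ω) = 0 := by
      rcases mul_eq_zero.mp e1.symm with h | h
      · exact absurd h (pow_ne_zero _ (by norm_num))
      · exact h
    simpa [mul_comm] using e3)
  have hd0 : d = 0 := by
    rw [Lp.eq_zero_iff_ae_eq_zero]
    filter_upwards [key, ae_restrict_mem Ω.isOpen.measurableSet] with x hx hxΩ
    exact hx hxΩ
  have : v - w = 0 := by simpa [hd, sub_eq_add_neg] using hd0
  exact sub_eq_zero.mp this

open Classical in
/-- The weak derivative `D^α u` in `L²(Ω)` (zero if there is none). -/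
def weakDeriv {N : ℕ} (Ω : Opens (Eucl N)) (α : Fin N → ℕ) (u : LpOn Ω 2) : LpOn Ω 2 :=
  if h : ∃ v, HasWeakDeriv Ω α u v then h.choose else 0

theorem HasWeakDeriv.weakDeriv_eq {N : ℕ} {Ω : Opens (Eucl N)} {α : Fin N → ℕ} {u v : LpOn Ω 2}
    (h : HasWeakDeriv Ω α u v) : weakDeriv Ω α u = v := by
  have hex : ∃ v, HasWeakDeriv Ω α u v := ⟨v, h⟩
  rw [weakDeriv, dif_pos hex]
  exact hex.choose_spec.unique h

/-- The functions in `L²(Ω)` with weak derivatives up to order `m` in `L²(Ω)`. -/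
def sobolevSubmodule {N : ℕ} (Ω : Opens (Eucl N)) (m : ℕ) : Submodule ℝ (LpOn Ω 2) where
  carrier := {u | ∀ α : Fin N → ℕ, miOrder α ≤ m → ∃ v, HasWeakDeriv Ω α u v}
  add_mem' := by
    intro u u' hu hu' α hα
    obtain ⟨v, hv⟩ := hu α hα
    obtain ⟨v', hv'⟩ := hu' α hα
    exact ⟨v + v', hv.add hv'⟩
  zero_mem' := fun α _ => ⟨0, HasWeakDeriv.zero Ω α⟩
  smul_mem' := by
    intro c u hu α hα
    obtain ⟨v, hv⟩ := hu α hα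
    exact ⟨c • v, hv.smul c⟩

/-- The Sobolev space `W^{m,2}(Ω)`; its norm is given below and differs from that of `L²(Ω)`. -/
def Sobolev {N : ℕ} (Ω : Opens (Eucl N)) (m : ℕ) : Type := sobolevSubmodule Ω m

namespace Sobolev

variable {N : ℕ} {Ω : Opens (Eucl N)} {m : ℕ}

instance : AddCommGroup (Sobolev Ω m) := inferInstanceAs (AddCommGroup (sobolevSubmodule Ω m))

instance : Module ℝ (Sobolev Ω m) := inferInstanceAs (Module ℝ (sobolevSubmodule Ω m))

/-- The embedding `W^{m,2}(Ω) → L²(Ω)`. -/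
def toL2 : Sobolev Ω m →ₗ[ℝ] LpOn Ω 2 := (sobolevSubmodule Ω m).subtype

/-- The weak derivative `D^α u` of `u ∈ W^{m,2}(Ω)`. -/
def D (α : Fin N → ℕ) (u : Sobolev Ω m) : LpOn Ω 2 := weakDeriv Ω α (toL2 u)

theorem hasWeakDeriv_D {α : Fin N → ℕ} (hα : miOrder α ≤ m) (u : Sobolev Ω m) :
    HasWeakDeriv Ω α (toL2 u) (D α u) := by
  obtain ⟨v, hv⟩ := u.2 α hα
  have : D α u = v := HasWeakDeriv.weakDeriv_eq hv
  rw [this]; exact hv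

theorem D_add {α : Fin N → ℕ} (hα : miOrder α ≤ m) (u v : Sobolev Ω m) :
    D α (u + v) = D α u + D α v :=
  HasWeakDeriv.weakDeriv_eq (by
    rw [map_add]; exact (hasWeakDeriv_D hα u).add (hasWeakDeriv_D hα v))

theorem D_smul {α : Fin N → ℕ} (hα : miOrder α ≤ m) (c : ℝ) (u : Sobolev Ω m) :
    D α (c • u) = c • D α u :=
  HasWeakDeriv.weakDeriv_eq (by
    rw [map_smul]; exact (hasWeakDeriv_D hα u).smul c)

/-- The map `u ↦ (u, (D^α u)_{|α| = m})` into a Hilbert sum of copies of `L²(Ω)`. -/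
def jet : Sobolev Ω m →ₗ[ℝ]
    WithLp 2 (LpOn Ω 2 × PiLp 2 (fun _ : {α // α ∈ miEQ N m} => LpOn Ω 2)) where
  toFun u := WithLp.toLp 2 (toL2 u, WithLp.toLp 2 fun α => D α.1 u)
  map_add' u v := by
    have h (α : {α // α ∈ miEQ N m}) : D α.1 (u + v) = D α.1 u + D α.1 v :=
      D_add (mem_miEQ.mp α.2).le u v
    simp only [map_add, h]
    rfl
  map_smul' c u := by
    have h (α : {α // α ∈ miEQ N m}) : D α.1 (c • u) = c • D α.1 u :=
      D_smul (mem_miEQ.mp α.2).le c u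
    simp only [map_smul, h]
    rfl

theorem jet_injective : Function.Injective (jet : Sobolev Ω m →ₗ[ℝ] _) := by
  intro u v h
  have : toL2 u = toL2 v := congrArg (fun z => z.fst) h
  exact Subtype.ext this

/-- `W^{m,2}(Ω)` carries the norm `(‖u‖² + ∑_{|α| = m} ‖D^α u‖²)^{1/2}` (all norms on the
right being those of `L²(Ω)`). -/
instance : NormedAddCommGroup (Sobolev Ω m) :=
  NormedAddCommGroup.induced _ _ (jet : Sobolev Ω m →ₗ[ℝ] _) jet_injective

instance : NormedSpace ℝ (Sobolev Ω m) :=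
  NormedSpace.induced ℝ _ _ (jet : Sobolev Ω m →ₗ[ℝ] _)

theorem norm_eq (u : Sobolev Ω m) :
    ‖u‖ = Real.sqrt (‖toL2 u‖ ^ 2 + ∑ α ∈ miEQ N m, ‖D α u‖ ^ 2) := by
  have h : ‖u‖ = ‖jet u‖ := rfl
  rw [h, WithLp.prod_norm_eq_of_L2]
  congr 2
  rw [PiLp.norm_sq_eq_of_L2]
  exact Finset.sum_coe_sort (miEQ N m) (fun α => ‖D α u‖ ^ 2)

end Sobolev

/-! ### The eigenvalue problem -/

section Problem

variable {N : ℕ} {Ω : Opens (Eucl N)} {m : ℕ}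

/-- The form `Q[u, φ] = ∫_Ω ∑_{|α|, |β| ≤ m} A_{αβ} D^α u D^β φ dx`. -/
def energyForm (A : (Fin N → ℕ) → (Fin N → ℕ) → LpOn Ω ∞) (u φ : Sobolev Ω m) : ℝ :=
  ∫ x in (Ω : Set (Eucl N)),
    ∑ α ∈ miLE N m, ∑ β ∈ miLE N m, A α β x * u.D α x * φ.D β x

/-- The product `⟨u, φ⟩_ρ = ∫_Ω u φ ρ dx`. -/
def massForm (ρ : LpOn Ω ∞) (u φ : Sobolev Ω m) : ℝ :=
  ∫ x in (Ω : Set (Eucl N)), u.toL2 x * φ.toL2 x * ρ x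

/-- The mass densities: those `ρ ∈ L^∞(Ω)` with `ess inf ρ > 0`. -/
def densities (Ω : Opens (Eucl N)) : Set (LpOn Ω ∞) :=
  {ρ | ∃ ε : ℝ, 0 < ε ∧ ∀ᵐ x ∂(volOn Ω), ε ≤ ρ x}

theorem integrable_mul_mul (a : LpOn Ω ∞) (u v : LpOn Ω 2) :
    Integrable (fun x => a x * u x * v x) (volOn Ω) := by
  have h1 : Integrable (fun x => u x * v x) (volOn Ω) :=
    MemLp.integrable_mul (p := 2) (q := 2) (Lp.memLp u) (Lp.memLp v)
  have h2 : Integrable (fun x => a x * (u x * v x)) (volOn Ω) :=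
    MemLp.integrable_mul (p := ∞) (q := 1) (Lp.memLp a) (memLp_one_iff_integrable.mpr h1)
  simpa only [mul_assoc] using h2

theorem integrable_mass (ρ : LpOn Ω ∞) (u v : LpOn Ω 2) :
    Integrable (fun x => u x * v x * ρ x) (volOn Ω) :=
  (integrable_mul_mul ρ u v).congr (Eventually.of_forall fun x => by ring)

theorem integrable_energy (A : (Fin N → ℕ) → (Fin N → ℕ) → LpOn Ω ∞) (u φ : Sobolev Ω m) :
    Integrable (fun x => ∑ α ∈ miLE N m, ∑ β ∈ miLE N m, A α β x * u.D α x * φ.D β x)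
      (volOn Ω) :=
  integrable_finsetSum _ fun α _ => integrable_finsetSum _ fun β _ =>
    integrable_mul_mul (A α β) (u.D α) (φ.D β)

theorem energyForm_add_left (A : (Fin N → ℕ) → (Fin N → ℕ) → LpOn Ω ∞) (u v φ : Sobolev Ω m) :
    energyForm A (u + v) φ = energyForm A u φ + energyForm A v φ := by
  unfold energyForm
  rw [← integral_add (integrable_energy A u φ) (integrable_energy A v φ)]
  apply integral_congr_ae
  have h : ∀ᵐ x ∂(volOn Ω), ∀ α ∈ miLE N m, (u + v).D α x = u.D α x + v.D α x := by
    rw [Filter.eventually_all_finset]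
    intro α hα
    rw [Sobolev.D_add (mem_miLE.mp hα)]
    exact Lp.coeFn_add _ _
  filter_upwards [h] with x hx
  simp only [← Finset.sum_add_distrib]
  refine Finset.sum_congr rfl fun α hα => Finset.sum_congr rfl fun β _ => ?_
  rw [hx α hα]; ring

theorem energyForm_smul_left (A : (Fin N → ℕ) → (Fin N → ℕ) → LpOn Ω ∞) (c : ℝ)
    (u φ : Sobolev Ω m) : energyForm A (c • u) φ = c * energyForm A u φ := by
  unfold energyForm
  rw [← integral_const_mul]
  apply integral_congr_ae
  have h : ∀ᵐ x ∂(volOn Ω), ∀ α ∈ miLE N m, (c • u).D α x = c * u.D α x := by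
    rw [Filter.eventually_all_finset]
    intro α hα
    rw [Sobolev.D_smul (mem_miLE.mp hα)]
    exact Lp.coeFn_smul _ _
  filter_upwards [h] with x hx
  simp only [Finset.mul_sum]
  refine Finset.sum_congr rfl fun α hα => Finset.sum_congr rfl fun β _ => ?_
  rw [hx α hα]; ring

theorem massForm_add_left (ρ : LpOn Ω ∞) (u v φ : Sobolev Ω m) :
    massForm ρ (u + v) φ = massForm ρ u φ + massForm ρ v φ := by
  unfold massForm
  rw [← integral_add (integrable_mass ρ u.toL2 φ.toL2) (integrable_mass ρ v.toL2 φ.toL2)]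
  apply integral_congr_ae
  rw [map_add]
  filter_upwards [Lp.coeFn_add u.toL2 v.toL2] with x hx
  rw [hx, Pi.add_apply]; ring

theorem massForm_smul_left (ρ : LpOn Ω ∞) (c : ℝ) (u φ : Sobolev Ω m) :
    massForm ρ (c • u) φ = c * massForm ρ u φ := by
  unfold massForm
  rw [← integral_const_mul]
  apply integral_congr_ae
  rw [map_smul]
  filter_upwards [Lp.coeFn_smul c u.toL2] with x hx
  rw [hx, Pi.smul_apply, smul_eq_mul]; ring

/-- The space of the `u ∈ V` that solve the weak problem `Q[u, φ] = t ⟨u, φ⟩_ρ` for all `φ ∈ V`;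
`t` is an eigenvalue if and only if this space is not zero. -/
def weakEigenspace (A : (Fin N → ℕ) → (Fin N → ℕ) → LpOn Ω ∞) (V : Submodule ℝ (Sobolev Ω m))
    (ρ : LpOn Ω ∞) (t : ℝ) : Submodule ℝ (Sobolev Ω m) where
  carrier := {u | u ∈ V ∧ ∀ φ ∈ V, energyForm A u φ = t * massForm ρ u φ}
  add_mem' := by
    rintro u v ⟨hu, hu'⟩ ⟨hv, hv'⟩
    refine ⟨V.add_mem hu hv, fun φ hφ => ?_⟩
    rw [energyForm_add_left, massForm_add_left, hu' φ hφ, hv' φ hφ, mul_add]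
  zero_mem' := by
    refine ⟨V.zero_mem, fun φ _ => ?_⟩
    have h1 := energyForm_smul_left A 0 (0 : Sobolev Ω m) φ
    have h2 := massForm_smul_left ρ 0 (0 : Sobolev Ω m) φ
    rw [zero_smul, zero_mul] at h1 h2
    rw [h1, h2, mul_zero]
  smul_mem' := by
    rintro c u ⟨hu, hu'⟩
    refine ⟨V.smul_mem c hu, fun φ hφ => ?_⟩
    rw [energyForm_smul_left, massForm_smul_left, hu' φ hφ]
    ring

/-- The Rayleigh quotient `Q[u, u] / ∫_Ω u² ρ dx`. -/
def rayleigh (A : (Fin N → ℕ) → (Fin N → ℕ) → LpOn Ω ∞) (ρ : LpOn Ω ∞) (u : Sobolev Ω m) : ℝ :=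
  energyForm A u u / massForm ρ u u

/-- `λ_n[ρ]`, for `1 ≤ n ≤ dim V`, through the min-max formula: the infimum, over all
`n`-dimensional subspaces `E` of `V`, of the largest Rayleigh quotient on `E \ {0}`. -/
def lam (A : (Fin N → ℕ) → (Fin N → ℕ) → LpOn Ω ∞) (V : Submodule ℝ (Sobolev Ω m))
    (n : ℕ) (ρ : LpOn Ω ∞) : ℝ :=
  sInf {s : ℝ | ∃ E : Submodule ℝ (Sobolev Ω m), E ≤ V ∧ Module.rank ℝ E = (n : Cardinal) ∧
    s = sSup (rayleigh A ρ '' {u : Sobolev Ω m | u ∈ E ∧ u ≠ 0})}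

/-- The positive integers `n ≤ dim V`; these are all positive integers if `dim V = ∞`. -/
def indexSet (V : Submodule ℝ (Sobolev Ω m)) : Set ℕ :=
  {n | 1 ≤ n ∧ (n : Cardinal) ≤ Module.rank ℝ V}

/-- The numbers `l n`, `1 ≤ n ≤ dim V`, are all the eigenvalues of the weak problem on `V`,
in nondecreasing order, each repeated as often as its multiplicity says; the multiplicities are
finite, and the sequence diverges to `+∞` if it is infinite. -/
structure IsEigenvalueSequence (A : (Fin N → ℕ) → (Fin N → ℕ) → LpOn Ω ∞)
    (V : Submodule ℝ (Sobolev Ω m)) (ρ : LpOn Ω ∞) (l : ℕ → ℝ) : Prop where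
  mono : MonotoneOn l (indexSet V)
  diverges : ∀ t : ℝ, {n | n ∈ indexSet V ∧ l n ≤ t}.Finite
  multiplicity : ∀ t : ℝ,
    Module.rank ℝ (weakEigenspace A V ρ t) = Cardinal.mk {n // n ∈ indexSet V ∧ l n = t}

/-- The weak* topology of `L^∞(Ω) = L¹(Ω)'`: the coarsest topology for which all the functionals
`ρ ↦ ∫_Ω ρ f dx` with `f ∈ L¹(Ω)` are continuous. -/
@[reducible] def weakStarTopology (Ω : Opens (Eucl N)) : TopologicalSpace (LpOn Ω ∞) :=
  TopologicalSpace.induced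
    (fun ρ (f : LpOn Ω 1) => ∫ x in (Ω : Set (Eucl N)), ρ x * f x) inferInstance

end Problem

end

noncomputable section

/-! ### Subspaces of prescribed dimension -/

/-! Everything is deduced from two symmetric forms `Q` and `M` on a normed space `X`, with an
injection `J` into a pre-Hilbert space `H` standing for the embedding into L².

Continuity. If `Q ≤ s M` on a trial space `E`, coercivity gives `a ‖u‖² ≤ (s + b) M u u` there. An
error `η ‖u‖²` in the mass is then a relative error `η (s + b) / a`, and `E` remains a good trial
space for the perturbed mass (`minMax_le_of_mass_close`). The admissible `η` does not depend on the
lower bounds of the densities (`exists_closeness`), so no uniform positivity on `C` is needed. Such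
an `η` is available weak*-near a given density (`eventually_mass_close`): `J` sends a ball of `V`
into a compact set, weak* convergence controls ∫f²ρ at the points of a finite net, and the bound on
`C` carries this from the net to the whole compact set. No eigenvector and no completeness is used.

Spectrum. Let G be the span of the eigenvectors with eigenvalue at most t. Eigenvectors for distinct
eigenvalues are `M`-orthogonal, so `Q ≤ t M` on G, and compactness makes G finite-dimensional. On
the `M`-complement of G the quotient attains its minimum at an eigenvector; this is where
completeness enters. That minimum must exceed t (`exists_gap`). Hence the n-th min-max value is at
most t exactly when n ≤ dim G (`minMax_le_iff`). Subtracting the same count for eigenvalues below t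
yields the multiplicities. -/

theorem Submodule.exists_le_rank_eq {X : Type*} [AddCommGroup X] [Module ℝ X]
    {V : Submodule ℝ X} {n : ℕ} (h : (n : Cardinal) ≤ Module.rank ℝ V) :
    ∃ E : Submodule ℝ X, E ≤ V ∧ Module.rank ℝ E = n := by
  obtain ⟨f, hf⟩ := Module.le_rank_iff_exists_linearMap.mp h
  refine ⟨LinearMap.range (V.subtype.comp f), ?_, ?_⟩
  · rintro _ ⟨x, rfl⟩
    exact (f x).2
  · have hinj : Function.Injective (V.subtype.comp f) := V.injective_subtype.comp hf
    have h1 := (LinearEquiv.ofInjective _ hinj).finrank_eq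
    have : Module.Finite ℝ (LinearMap.range (V.subtype.comp f)) := inferInstance
    rw [← Module.finrank_eq_rank, ← h1]
    simp

/-! ### Min-max values of a pair of symmetric forms -/

/-- The `n`-th min-max value of the quotient `Q[u, u] / M[u, u]` over the subspace `V`. -/
def minMax {X : Type*} [AddCommGroup X] [Module ℝ X] (Q M : LinearMap.BilinForm ℝ X)
    (V : Submodule ℝ X) (n : ℕ) : ℝ :=
  sInf {s : ℝ | ∃ E : Submodule ℝ X, E ≤ V ∧ Module.rank ℝ E = (n : Cardinal) ∧
    s = sSup ((fun u => Q u u / M u u) '' {u : X | u ∈ E ∧ u ≠ 0})}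

/-- On `V`, the form `Q` is bounded above and `Q + b M` is coercive; `M` is equivalent to the
square of the norm of the pre-Hilbert space `H` into which `J` maps. -/
structure CoercivePair {X H : Type*} [NormedAddCommGroup X] [NormedSpace ℝ X]
    [NormedAddCommGroup H] [InnerProductSpace ℝ H] (J : X →ₗ[ℝ] H)
    (Q M : LinearMap.BilinForm ℝ X) (V : Submodule ℝ X) (a b c e R : ℝ) : Prop where
  symmQ : ∀ u v, Q u v = Q v u
  symmM : ∀ u v, M u v = M v u
  a_pos : 0 < a
  e_pos : 0 < e
  coercive : ∀ u ∈ V, a * ‖u‖ ^ 2 ≤ Q u u + b * M u u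
  upper : ∀ u ∈ V, Q u u ≤ c * ‖u‖ ^ 2
  lowerM : ∀ u, e * ‖J u‖ ^ 2 ≤ M u u
  boundM : ∀ u v, |M u v| ≤ R * ‖J u‖ * ‖J v‖
  inj : Function.Injective J
  norm_le : ∀ u, ‖J u‖ ≤ ‖u‖

namespace CoercivePair

variable {X H : Type*} [NormedAddCommGroup X] [NormedSpace ℝ X] [NormedAddCommGroup H]
  [InnerProductSpace ℝ H] {J : X →ₗ[ℝ] H} {Q M : LinearMap.BilinForm ℝ X} {V : Submodule ℝ X}
  {a b c e R : ℝ}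

theorem mass_nonneg (h : CoercivePair J Q M V a b c e R) (u : X) : 0 ≤ M u u :=
  le_trans (mul_nonneg h.e_pos.le (sq_nonneg _)) (h.lowerM u)

theorem mass_pos (h : CoercivePair J Q M V a b c e R) {u : X} (hu : u ≠ 0) : 0 < M u u := by
  have : J u ≠ 0 := fun h0 => hu (h.inj (by simpa using h0))
  have := norm_pos_iff.mpr this
  exact lt_of_lt_of_le (mul_pos h.e_pos (by positivity)) (h.lowerM u)

theorem eq_zero_of_mass (h : CoercivePair J Q M V a b c e R) {u : X} (hu : M u u = 0) :
    u = 0 := by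
  by_contra h0
  exact (h.mass_pos h0).ne' hu

theorem mass_le (h : CoercivePair J Q M V a b c e R) (u : X) : M u u ≤ R * ‖J u‖ ^ 2 := by
  have := le_trans (le_abs_self _) (h.boundM u u)
  rwa [mul_assoc, ← sq] at this

theorem neg_mass_le (h : CoercivePair J Q M V a b c e R) {u : X} (hu : u ∈ V) :
    -b * M u u ≤ Q u u := by
  have := h.coercive u hu
  have : 0 ≤ a * ‖u‖ ^ 2 := mul_nonneg h.a_pos.le (sq_nonneg _)
  linarith

/-- On a finite-dimensional space the injective map `J` is bounded below, so the norm is controlled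
by the mass. This makes the suprema in `minMax` genuine ones rather than the default value 0 of
`sSup`. -/
theorem exists_le_mass (h : CoercivePair J Q M V a b c e R) {E : Submodule ℝ X} (hE : E ≤ V)
    [FiniteDimensional ℝ E] : ∃ s, ∀ u ∈ E, Q u u ≤ s * M u u := by
  obtain ⟨K, -, hK⟩ := LinearMap.exists_antilipschitzWith (J.comp E.subtype)
    (LinearMap.ker_eq_bot.mpr (h.inj.comp E.injective_subtype))
  refine ⟨|c| * (K ^ 2 / e), fun u hu => ?_⟩
  have h1 : ‖u‖ ≤ K * ‖J u‖ := by
    have := hK.le_mul_dist ⟨u, hu⟩ 0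
    simpa [dist_eq_norm] using this
  have h2 : ‖u‖ ^ 2 ≤ K ^ 2 * ‖J u‖ ^ 2 := by
    rw [← mul_pow]; exact pow_le_pow_left₀ (norm_nonneg _) h1 2
  have h3 : ‖J u‖ ^ 2 ≤ M u u / e := by
    rw [le_div_iff₀ h.e_pos, mul_comm]; exact h.lowerM u
  calc Q u u ≤ c * ‖u‖ ^ 2 := h.upper u (hE hu)
    _ ≤ |c| * ‖u‖ ^ 2 := by gcongr; exact le_abs_self c
    _ ≤ |c| * (K ^ 2 * (M u u / e)) := by gcongr; exact h2.trans (by gcongr)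
    _ = |c| * (K ^ 2 / e) * M u u := by ring

theorem bddAbove_quotient (h : CoercivePair J Q M V a b c e R) {E : Submodule ℝ X} (hE : E ≤ V)
    [FiniteDimensional ℝ E] :
    BddAbove ((fun u => Q u u / M u u) '' {u : X | u ∈ E ∧ u ≠ 0}) := by
  obtain ⟨s, hs⟩ := h.exists_le_mass hE
  refine ⟨s, ?_⟩
  rintro _ ⟨u, ⟨hu, h0⟩, rfl⟩
  exact (div_le_iff₀ (h.mass_pos h0)).mpr (hs u hu)

theorem exists_mem_ne_zero {E : Submodule ℝ X} {n : ℕ} (hn : 1 ≤ n)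
    (hE : Module.rank ℝ E = (n : Cardinal)) : ∃ u ∈ E, u ≠ 0 := by
  apply Submodule.exists_mem_ne_zero_of_ne_bot
  rintro rfl
  rw [rank_bot] at hE
  have : n = 0 := by exact_mod_cast hE.symm
  omega

theorem finiteDimensional_of_rank_eq {E : Submodule ℝ X} {n : ℕ}
    (hE : Module.rank ℝ E = (n : Cardinal)) : FiniteDimensional ℝ E :=
  Module.finite_of_rank_eq_nat hE

/-- Together with `exists_of_minMax_lt` this trades the infimum of suprema for the inequality `Q ≤ s
M` on a trial space, which has no division and includes `u = 0`. -/
theorem minMax_le (h : CoercivePair J Q M V a b c e R) {n : ℕ} (hn : 1 ≤ n) {E : Submodule ℝ X}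
    (hEV : E ≤ V) (hE : Module.rank ℝ E = (n : Cardinal)) {s : ℝ}
    (hs : ∀ u ∈ E, Q u u ≤ s * M u u) : minMax Q M V n ≤ s := by
  have hmem : sSup ((fun u => Q u u / M u u) '' {u : X | u ∈ E ∧ u ≠ 0}) ∈
      {s : ℝ | ∃ E : Submodule ℝ X, E ≤ V ∧ Module.rank ℝ E = (n : Cardinal) ∧
        s = sSup ((fun u => Q u u / M u u) '' {u : X | u ∈ E ∧ u ≠ 0})} := ⟨E, hEV, hE, rfl⟩
  -- By coercivity `-b` bounds every quotient from below; `1 ≤ n` supplies a nonzero vector, so each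
  -- supremum inherits the bound.
  refine (csInf_le ⟨-b, ?_⟩ hmem).trans (csSup_le ?_ ?_)
  · rintro _ ⟨F, hFV, hF, rfl⟩
    have := finiteDimensional_of_rank_eq hF
    obtain ⟨u, hu, h0⟩ := exists_mem_ne_zero hn hF
    refine le_trans ?_ (le_csSup (h.bddAbove_quotient hFV) ⟨u, ⟨hu, h0⟩, rfl⟩)
    exact (le_div_iff₀ (h.mass_pos h0)).mpr (h.neg_mass_le (hFV hu))
  · obtain ⟨u, hu, h0⟩ := exists_mem_ne_zero hn hE
    exact ⟨_, u, ⟨hu, h0⟩, rfl⟩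
  · rintro _ ⟨u, ⟨hu, h0⟩, rfl⟩
    exact (div_le_iff₀ (h.mass_pos h0)).mpr (hs u hu)

theorem exists_of_minMax_lt (h : CoercivePair J Q M V a b c e R) {n : ℕ}
    (hn : (n : Cardinal) ≤ Module.rank ℝ V) {s : ℝ} (hs : minMax Q M V n < s) :
    ∃ E : Submodule ℝ X, E ≤ V ∧ Module.rank ℝ E = (n : Cardinal) ∧
      ∀ u ∈ E, Q u u ≤ s * M u u := by
  obtain ⟨E₀, hE₀, hE₀'⟩ := Submodule.exists_le_rank_eq hn
  have hne : {s : ℝ | ∃ E : Submodule ℝ X, E ≤ V ∧ Module.rank ℝ E = (n : Cardinal) ∧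
      s = sSup ((fun u => Q u u / M u u) '' {u : X | u ∈ E ∧ u ≠ 0})}.Nonempty :=
    ⟨_, E₀, hE₀, hE₀', rfl⟩
  obtain ⟨_, ⟨E, hEV, hE, rfl⟩, hlt⟩ := exists_lt_of_csInf_lt hne hs
  refine ⟨E, hEV, hE, fun u hu => ?_⟩
  have := finiteDimensional_of_rank_eq hE
  rcases eq_or_ne u 0 with rfl | h0
  · simp
  · exact (div_le_iff₀ (h.mass_pos h0)).mp
      ((le_csSup (h.bddAbove_quotient hEV) ⟨u, ⟨hu, h0⟩, rfl⟩).trans hlt.le)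

/-- A trial space of dimension `n` contains one of dimension `k`, with the same bound on the
quotient. -/
theorem minMax_mono (h : CoercivePair J Q M V a b c e R) {k n : ℕ} (hk : 1 ≤ k) (hkn : k ≤ n)
    (hn : (n : Cardinal) ≤ Module.rank ℝ V) : minMax Q M V k ≤ minMax Q M V n := by
  refine le_of_forall_gt_imp_ge_of_dense fun s hs => ?_
  obtain ⟨E, hEV, hE, hQ⟩ := h.exists_of_minMax_lt hn hs
  have hk' : (k : Cardinal) ≤ Module.rank ℝ E := by rw [hE]; exact_mod_cast hkn
  obtain ⟨F, hFE, hF⟩ := Submodule.exists_le_rank_eq hk'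
  exact h.minMax_le hk (hFE.trans hEV) hF fun u hu => hQ u (hFE hu)

/-- Masses that are close relative to the norm have close min-max values. -/
theorem minMax_le_of_mass_close {M' : LinearMap.BilinForm ℝ X} {e' R' : ℝ}
    (h : CoercivePair J Q M V a b c e R) (h' : CoercivePair J Q M' V a b c e' R') {n : ℕ}
    (hn1 : 1 ≤ n) (hn : (n : Cardinal) ≤ Module.rank ℝ V) {s η : ℝ} (hη : 0 ≤ η)
    (hs : minMax Q M V n < s) (hclose : ∀ u ∈ V, |M u u - M' u u| ≤ η * ‖u‖ ^ 2)
    (hκ : η * (s + b) / a ≤ 1 / 2) :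
    minMax Q M' V n ≤ s + 2 * |s| * (η * (s + b) / a) := by
  obtain ⟨E, hEV, hE, hQ⟩ := h.exists_of_minMax_lt hn hs
  refine h'.minMax_le hn1 hEV hE fun u hu => ?_
  have ha := h.a_pos
  have h1 : |M u u - M' u u| ≤ η * (s + b) / a * M u u := by
    have h2 : ‖u‖ ^ 2 ≤ (s + b) * M u u / a := by
      rw [le_div_iff₀ ha]
      have := h.coercive u (hEV hu)
      have := hQ u hu
      linarith
    calc |M u u - M' u u| ≤ η * ‖u‖ ^ 2 := hclose u (hEV hu)
      _ ≤ η * ((s + b) * M u u / a) := by gcongr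
      _ = _ := by ring
  set κ := η * (s + b) / a
  have hM := h.mass_nonneg u
  have hκ0 : 0 ≤ κ * M u u := (abs_nonneg _).trans h1
  have h3 : κ * M u u ≤ 1 / 2 * M u u := by gcongr
  have h4 : M u u ≤ 2 * M' u u := by
    have := (abs_le.mp h1).2
    linarith
  -- The sign of `s + b`, hence of `κ`, is not known beforehand: `κ * M u u ≥ 0` forces `κ ≥ 0`
  -- unless `M u u = 0`, that is, unless `u = 0`.
  have h5 : κ * M u u ≤ κ * (2 * M' u u) := by
    rcases hM.eq_or_lt with h0 | h0
    · have : M' u u = 0 := by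
        rw [h'.eq_zero_of_mass (u := u) (by rw [h.eq_zero_of_mass h0.symm]; simp)]; simp
      rw [← h0, this]; simp
    · exact mul_le_mul_of_nonneg_left h4 (nonneg_of_mul_nonneg_left hκ0 h0)
  have h6 : s * (M u u - M' u u) ≤ |s| * (κ * M u u) :=
    (le_abs_self _).trans (by rw [abs_mul]; gcongr)
  have h7 : |s| * (κ * M u u) ≤ |s| * (κ * (2 * M' u u)) := by gcongr
  have := hQ u hu
  linarith

/-- A uniform version of `minMax_le_of_mass_close`. -/
theorem exists_closeness {X H : Type*} [NormedAddCommGroup X] [NormedSpace ℝ X]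
    [NormedAddCommGroup H] [InnerProductSpace ℝ H] {J : X →ₗ[ℝ] H}
    {V : Submodule ℝ X} {a b c : ℝ} (ha : 0 < a) {n : ℕ} (hn1 : 1 ≤ n)
    (hn : (n : Cardinal) ≤ Module.rank ℝ V) (s : ℝ) {δ : ℝ} (hδ : 0 < δ) :
    ∃ η > 0, ∀ (Q M M' : LinearMap.BilinForm ℝ X) (e R e' R' : ℝ),
      CoercivePair J Q M V a b c e R → CoercivePair J Q M' V a b c e' R' →
      (∀ u ∈ V, |M u u - M' u u| ≤ η * ‖u‖ ^ 2) →
      minMax Q M V n < s → minMax Q M' V n ≤ s + δ := by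
  have hD : 0 < |s + b| / a + 1 := by positivity
  have hs0 : 0 < 2 * |s| + 1 := by positivity
  have hmin : 0 < min (1 / 2) (δ / (2 * |s| + 1)) := by positivity
  -- This makes the relative error at most both 1/2, as `minMax_le_of_mass_close` asks, and `δ / (2
  -- |s| + 1)`, so that `2 |s|` times it stays below `δ`. The summands 1 keep the denominators
  -- positive.
  refine ⟨min (1 / 2) (δ / (2 * |s| + 1)) / (|s + b| / a + 1), by positivity, ?_⟩
  intro Q M M' e R e' R' h h' hclose hs
  set q := min (1 / 2) (δ / (2 * |s| + 1))
  set η := q / (|s + b| / a + 1)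
  have hη : 0 < η := by positivity
  have hκ : η * (s + b) / a ≤ q := by
    calc η * (s + b) / a ≤ η * |s + b| / a := by gcongr; exact le_abs_self _
      _ = η * (|s + b| / a) := by ring
      _ ≤ η * (|s + b| / a + 1) := by gcongr; linarith
      _ = q := div_mul_cancel₀ _ hD.ne'
  refine (h.minMax_le_of_mass_close h' hn1 hn hη.le hs hclose
    (hκ.trans (min_le_left _ _))).trans ?_
  have h1 : η * (s + b) / a ≤ δ / (2 * |s| + 1) := hκ.trans (min_le_right _ _)
  have h2 : 2 * |s| * (η * (s + b) / a) ≤ 2 * |s| * (δ / (2 * |s| + 1)) := by gcongr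
  have h3 : 2 * |s| * (δ / (2 * |s| + 1)) ≤ δ := by
    rw [mul_div_assoc', div_le_iff₀ hs0]; nlinarith
  linarith

end CoercivePair

/-- `J` maps some ball of `V` into a compact set. -/
def IsCompactMapOn {X H : Type*} [NormedAddCommGroup X] [NormedSpace ℝ X]
    [NormedAddCommGroup H] [InnerProductSpace ℝ H] (J : X →ₗ[ℝ] H) (V : Submodule ℝ X) : Prop :=
  ∃ K : Set H, IsCompact K ∧ ∃ r : ℝ, 0 < r ∧ ∀ u ∈ V, ‖u‖ ≤ r → J u ∈ K

/-! ### Compactness: bounded dimension and Cauchy subsequences -/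

namespace IsCompactMapOn

variable {X H : Type*} [NormedAddCommGroup X] [NormedSpace ℝ X] [NormedAddCommGroup H]
  [InnerProductSpace ℝ H] {J : X →ₗ[ℝ] H} {V : Submodule ℝ X}

/-- The subspaces on which the norm is controlled by that of `H` have bounded dimension. -/
theorem exists_rank_le (hJ : IsCompactMapOn J V) (hinj : Function.Injective J) (C : ℝ) :
    ∃ m : ℕ, ∀ E : Submodule ℝ X, E ≤ V → (∀ u ∈ E, ‖u‖ ≤ C * ‖J u‖) →
      Module.rank ℝ E ≤ m := by
  obtain ⟨K, hK, r, hr, hrK⟩ := hJ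
  set C' := max C 1
  have hC' : 0 < C' := lt_max_of_lt_right one_pos
  set δ := r / C'
  have hδ : 0 < δ := div_pos hr hC'
  obtain ⟨t, htfin, ht⟩ := Metric.totallyBounded_iff.mp hK.totallyBounded (δ / 2) (half_pos hδ)
  lift t to Finset H using htfin
  refine ⟨t.card, fun E hEV hE => ?_⟩
  by_contra! hlt
  have hlt' : ((t.card + 1 : ℕ) : Cardinal) ≤ Module.rank ℝ E := by
    have := Order.succ_le_of_lt hlt
    rwa [Cardinal.succ_natCast, ← Nat.cast_succ] at this
  obtain ⟨F, hFE, hF⟩ := Submodule.exists_le_rank_eq hlt'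
  have : FiniteDimensional ℝ F := Module.finite_of_rank_eq_nat hF
  have hfr : Module.finrank ℝ (F.map J) = t.card + 1 := by
    rw [← (F.equivMapOfInjective J hinj).finrank_eq]
    exact Module.finrank_eq_of_rank_eq hF
  -- The vectors `δ • o i` lie in `K` at mutual distance `√2 δ`, so two of them cannot be within `δ
  -- / 2` of the same net point; there are `t.card + 1` of them.
  let o := stdOrthonormalBasis ℝ (F.map J)
  have hpt : ∀ i, ∃ y ∈ t, dist (δ • (o i : H)) y < δ / 2 := by
    intro i
    obtain ⟨u, huF, hu⟩ := (o i).2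
    have hnorm : ‖J u‖ = 1 := by rw [hu]; exact o.orthonormal.1 i
    have h1 : ‖u‖ ≤ C' := by
      have := hE u (hFE huF)
      rw [hnorm, mul_one] at this
      exact this.trans (le_max_left _ _)
    have h2 : ‖δ • u‖ ≤ r := by
      rw [norm_smul, Real.norm_of_nonneg hδ.le]
      calc δ * ‖u‖ ≤ δ * C' := by gcongr
        _ = r := div_mul_cancel₀ _ hC'.ne'
    have h3 := ht (hrK _ (V.smul_mem δ (hEV (hFE huF))) h2)
    rw [map_smul, hu] at h3
    simpa using h3
  choose y hyt hy using hpt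
  obtain ⟨i, -, j, -, hij, hyij⟩ := Finset.exists_ne_map_eq_of_card_lt_of_maps_to
    (s := Finset.univ) (t := t) (by simp [hfr]) (fun i _ => hyt i)
  have hd : dist (δ • (o i : H)) (δ • (o j : H)) < δ := by
    calc _ ≤ dist (δ • (o i : H)) (y i) + dist (δ • (o j : H)) (y i) := dist_triangle_right _ _ _
      _ < δ / 2 + δ / 2 := add_lt_add (hy i) (by rw [hyij]; exact hy j)
      _ = δ := add_halves δ
  rw [dist_smul₀, Real.norm_of_nonneg hδ.le, dist_eq_norm] at hd
  have hlt1 : ‖(o i : H) - o j‖ < 1 := by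
    by_contra! h1
    nlinarith
  have hsq : ‖(o i : H) - o j‖ ^ 2 = 2 := by
    have e1 : ‖(o i : H)‖ = 1 := o.orthonormal.1 i
    have e2 : ‖(o j : H)‖ = 1 := o.orthonormal.1 j
    have e3 : inner ℝ (o i : H) (o j : H) = 0 := o.orthonormal.2 hij
    rw [norm_sub_sq_real, e1, e2, e3]; norm_num
  nlinarith [norm_nonneg ((o i : H) - o j)]

/-- A bounded sequence in `V` has a subsequence whose image in `H` is Cauchy. -/
theorem exists_subseq_cauchy (hJ : IsCompactMapOn J V) {u : ℕ → X} (hu : ∀ k, u k ∈ V) {B : ℝ}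
    (hB : ∀ k, ‖u k‖ ≤ B) :
    ∃ φ : ℕ → ℕ, StrictMono φ ∧ CauchySeq fun k => J (u (φ k)) := by
  obtain ⟨K, hK, r, hr, hrK⟩ := hJ
  have hB0 : 0 < |B| + 1 := by positivity
  set δ := r / (|B| + 1)
  have hδ : 0 < δ := div_pos hr hB0
  have hmem : ∀ k, J (δ • u k) ∈ K := fun k => by
    refine hrK _ (V.smul_mem _ (hu k)) ?_
    rw [norm_smul, Real.norm_of_nonneg hδ.le]
    calc δ * ‖u k‖ ≤ δ * (|B| + 1) := by
          gcongr; linarith [hB k, le_abs_self B]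
      _ = r := div_mul_cancel₀ _ hB0.ne'
  obtain ⟨z, -, φ, hφ, hz⟩ := hK.tendsto_subseq hmem
  refine ⟨φ, hφ, ?_⟩
  have heq : (fun k => J (u (φ k))) = fun k => δ⁻¹ • J (δ • u (φ k)) := by
    funext k
    rw [map_smul, inv_smul_smul₀ hδ.ne']
  rw [heq]
  exact (hz.const_smul δ⁻¹).cauchySeq

end IsCompactMapOn

/-! ### Direct method, eigenspaces and the counting of eigenvalues -/

namespace CoercivePair

variable {X H : Type*} [NormedAddCommGroup X] [NormedSpace ℝ X] [NormedAddCommGroup H]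
  [InnerProductSpace ℝ H] {J : X →ₗ[ℝ] H} {Q M : LinearMap.BilinForm ℝ X} {V : Submodule ℝ X}
  {a b c e R : ℝ}

/-- The dimension of a subspace on which the quotient is at most `t` is bounded. -/
theorem exists_rank_le (h : CoercivePair J Q M V a b c e R) (hJ : IsCompactMapOn J V) (t : ℝ) :
    ∃ m : ℕ, ∀ E : Submodule ℝ X, E ≤ V → (∀ u ∈ E, Q u u ≤ t * M u u) →
      Module.rank ℝ E ≤ m := by
  have ha := h.a_pos
  -- From `a ‖u‖² ≤ (t + b) M u u ≤ |t + b| |R| ‖J u‖²`.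
  obtain ⟨m, hm⟩ := hJ.exists_rank_le h.inj (√(|t + b| * |R| / a))
  refine ⟨m, fun E hEV hE => hm E hEV fun u hu => ?_⟩
  rw [← Real.sqrt_sq (norm_nonneg (J u)), ← Real.sqrt_mul (by positivity)]
  apply Real.le_sqrt_of_sq_le
  rw [div_mul_eq_mul_div, le_div_iff₀ ha]
  calc ‖u‖ ^ 2 * a ≤ (t + b) * M u u := by linarith [h.coercive u (hEV hu), hE u hu]
    _ ≤ |t + b| * M u u := mul_le_mul_of_nonneg_right (le_abs_self _) (h.mass_nonneg u)
    _ ≤ |t + b| * (|R| * ‖J u‖ ^ 2) := by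
      gcongr
      exact (h.mass_le u).trans (by gcongr; exact le_abs_self R)
    _ = _ := by ring

theorem continuous_mass_left (h : CoercivePair J Q M V a b c e R) (g : X) :
    Continuous fun u => M u g := by
  refine (LinearMap.mkContinuous (M.flip g) (|R| * ‖J g‖) fun u => ?_).continuous
  rw [Real.norm_eq_abs]
  calc |M u g| ≤ R * ‖J u‖ * ‖J g‖ := h.boundM u g
    _ ≤ |R| * ‖u‖ * ‖J g‖ := by
      gcongr
      · exact le_abs_self R
      · exact h.norm_le u
    _ = _ := by ring

/-- The `M`-orthogonal complement of `G` in `V`. -/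
def massCompl (_ : CoercivePair J Q M V a b c e R) (G : Submodule ℝ X) : Submodule ℝ X where
  carrier := {u | u ∈ V ∧ ∀ g ∈ G, M u g = 0}
  add_mem' := by
    rintro u v ⟨hu, hu'⟩ ⟨hv, hv'⟩
    refine ⟨V.add_mem hu hv, fun g hg => ?_⟩
    rw [map_add, LinearMap.add_apply, hu' g hg, hv' g hg, add_zero]
  zero_mem' := ⟨V.zero_mem, fun g _ => by simp⟩
  smul_mem' := by
    rintro t u ⟨hu, hu'⟩
    refine ⟨V.smul_mem t hu, fun g hg => ?_⟩
    rw [map_smul, LinearMap.smul_apply, hu' g hg, smul_zero]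

/-- The complement is cut out of `V` by closed conditions. The argument runs through filters because
only `V`, not `X`, is complete. -/
theorem isComplete_massCompl (h : CoercivePair J Q M V a b c e R)
    (hV : IsComplete (V : Set X)) (G : Submodule ℝ X) :
    IsComplete (h.massCompl G : Set X) := by
  have hc : IsClosed {u : X | ∀ g ∈ G, M u g = 0} := by
    simp only [ofPred_forall]
    exact isClosed_iInter fun g => isClosed_iInter fun _ =>
      isClosed_eq (h.continuous_mass_left g) continuous_const
  intro f hf hfW
  obtain ⟨x, hx, hfx⟩ := hV f hf (hfW.trans (by
    rw [le_principal_iff]; exact mem_principal.mpr fun u hu => hu.1))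
  have := hf.1
  refine ⟨x, ⟨hx, hc.mem_of_tendsto (f := id) hfx ?_⟩, hfx⟩
  exact mem_of_superset (le_principal_iff.mp hfW) fun u hu => hu.2

/-- `M` is definite on the finite-dimensional `G`, so it identifies `G` with its dual; `g`
represents the functional `M v` on `G`. -/
theorem exists_sub_mem_massCompl (h : CoercivePair J Q M V a b c e R) {G : Submodule ℝ X}
    (hG : G ≤ V) [FiniteDimensional ℝ G] {v : X} (hv : v ∈ V) :
    ∃ g ∈ G, v - g ∈ h.massCompl G := by
  let f : G →ₗ[ℝ] Module.Dual ℝ G := (M.domRestrict₁₂ G G)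
  have hf : Function.Injective f := by
    rw [← LinearMap.ker_eq_bot, LinearMap.ker_eq_bot']
    intro g hg
    have : M g g = 0 := DFunLike.congr_fun hg g
    exact Subtype.ext (h.eq_zero_of_mass this)
  obtain ⟨g, hg⟩ := (LinearMap.injective_iff_surjective_of_finrank_eq_finrank
    (Subspace.dual_finrank_eq).symm).mp hf ((M v).domRestrict G)
  refine ⟨g, g.2, V.sub_mem hv (hG g.2), fun k hk => ?_⟩
  have : M g k = M v k := DFunLike.congr_fun hg (⟨k, hk⟩ : G)
  rw [map_sub, LinearMap.sub_apply, this, sub_self]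

/-- A linear map from `E` to the dual of the smaller space `G` has a nonzero kernel. -/
theorem exists_mem_massCompl (h : CoercivePair J Q M V a b c e R) {G E : Submodule ℝ X}
    (hE : E ≤ V) [FiniteDimensional ℝ G] [FiniteDimensional ℝ E]
    (hlt : Module.finrank ℝ G < Module.finrank ℝ E) :
    ∃ u ∈ E, u ≠ 0 ∧ u ∈ h.massCompl G := by
  let f : E →ₗ[ℝ] Module.Dual ℝ G := (M.domRestrict₁₂ E G)
  have hker : LinearMap.ker f ≠ ⊥ := LinearMap.ker_ne_bot_of_finrank_lt (by
    rwa [Subspace.dual_finrank_eq])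
  obtain ⟨u, hu, h0⟩ := Submodule.exists_mem_ne_zero_of_ne_bot hker
  refine ⟨u, u.2, by simpa using h0, hE u.2, fun g hg => ?_⟩
  exact DFunLike.congr_fun (LinearMap.mem_ker.mp hu) (⟨g, hg⟩ : G)

/-- On a nonzero complete subspace the quotient attains its minimum, at an eigenvector. -/
theorem exists_minimizer (h : CoercivePair J Q M V a b c e R) (hJ : IsCompactMapOn J V)
    {W : Submodule ℝ X} (hWV : W ≤ V) (hW : IsComplete (W : Set X)) (hne : W ≠ ⊥) :
    ∃ l : ℝ, (∀ u ∈ W, l * M u u ≤ Q u u) ∧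
      ∃ w ∈ W, w ≠ 0 ∧ ∀ φ ∈ W, Q w φ = l * M w φ := by
  have ha := h.a_pos
  set S : Set ℝ := (fun u => Q u u) '' {u : X | u ∈ W ∧ M u u = 1}
  have hscale : ∀ u ∈ W, u ≠ 0 → ∃ v ∈ W, M v v = 1 ∧ Q v v * M u u = Q u u := by
    intro u hu h0
    have hp := h.mass_pos h0
    refine ⟨(√(M u u))⁻¹ • u, W.smul_mem _ hu, ?_, ?_⟩
    · simp only [map_smul, LinearMap.smul_apply, smul_eq_mul]
      rw [← mul_assoc, ← mul_inv, Real.mul_self_sqrt hp.le, inv_mul_cancel₀ hp.ne']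
    · simp only [map_smul, LinearMap.smul_apply, smul_eq_mul]
      rw [← mul_assoc, ← mul_inv, Real.mul_self_sqrt hp.le]
      field_simp
  have hSne : S.Nonempty := by
    obtain ⟨u, hu, h0⟩ := Submodule.exists_mem_ne_zero_of_ne_bot hne
    obtain ⟨v, hv, hv1, -⟩ := hscale u hu h0
    exact ⟨_, v, ⟨hv, hv1⟩, rfl⟩
  have hSb : BddBelow S := by
    refine ⟨-b, ?_⟩
    rintro _ ⟨u, ⟨hu, hu1⟩, rfl⟩
    simpa [hu1] using h.neg_mass_le (hWV hu)
  set l := sInf S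
  have hl : ∀ u ∈ W, l * M u u ≤ Q u u := by
    intro u hu
    rcases eq_or_ne u 0 with rfl | h0
    · simp
    obtain ⟨v, hv, hv1, hv2⟩ := hscale u hu h0
    rw [← hv2]
    exact mul_le_mul_of_nonneg_right (csInf_le hSb ⟨v, ⟨hv, hv1⟩, rfl⟩) (h.mass_nonneg u)
  -- `F` is positive semidefinite on `W`, with infimum 0 on the `M`-unit sphere. A minimizing
  -- sequence is shown to be Cauchy in norm, and its limit lies in the null space of `F`.
  let F : LinearMap.BilinForm ℝ X := Q - l • M
  have hFdef : ∀ x y, F x y = Q x y - l * M x y := fun x y => rfl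
  have hF0 : ∀ u ∈ W, 0 ≤ F u u := fun u hu => by rw [hFdef]; linarith [hl u hu]
  have hFsymm : ∀ x y, F x y = F y x := fun x y => by
    rw [hFdef, hFdef, h.symmQ x y, h.symmM x y]
  have hpar : ∀ x ∈ W, ∀ y ∈ W, F (x - y) (x - y) ≤ 2 * F x x + 2 * F y y := by
    intro x hx y hy
    have := hF0 _ (W.add_mem hx hy)
    simp only [map_add, map_sub, LinearMap.add_apply, LinearMap.sub_apply] at this ⊢
    linarith
  have hseq : ∀ k : ℕ, ∃ u ∈ W, M u u = 1 ∧ F u u < 1 / ((k : ℝ) + 1) := by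
    intro k
    obtain ⟨_, ⟨u, ⟨hu, hu1⟩, rfl⟩, hlt⟩ := exists_lt_of_csInf_lt hSne
      (lt_add_of_pos_right l (Nat.one_div_pos_of_nat (n := k) (α := ℝ)))
    refine ⟨u, hu, hu1, ?_⟩
    rw [hFdef, hu1]
    simp only at hlt
    linarith
  choose u huW hu1 huF using hseq
  have hbound : ∀ k, ‖u k‖ ≤ √((l + 1 + b) / a) := by
    intro k
    apply Real.le_sqrt_of_sq_le
    rw [le_div_iff₀ ha]
    have h1 := h.coercive _ (hWV (huW k))
    have h2 := huF k
    have h3 : 1 / ((k : ℝ) + 1) ≤ 1 := by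
      rw [div_le_one (by positivity)]; linarith [k.cast_nonneg (α := ℝ)]
    rw [hFdef] at h2
    rw [hu1 k] at h1 h2
    linarith
  obtain ⟨φ, hφ, hcau⟩ := hJ.exists_subseq_cauchy (fun k => hWV (huW k)) hbound
  have hest : ∀ x ∈ W, a * ‖x‖ ^ 2 ≤ F x x + |l + b| * |R| * ‖J x‖ ^ 2 := by
    intro x hx
    have h1 := h.coercive x (hWV hx)
    have h2 : (l + b) * M x x ≤ |l + b| * (|R| * ‖J x‖ ^ 2) := by
      refine (mul_le_mul_of_nonneg_right (le_abs_self _) (h.mass_nonneg x)).trans ?_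
      gcongr
      exact (h.mass_le x).trans (by gcongr; exact le_abs_self R)
    rw [hFdef]
    linarith
  have hcauchy : CauchySeq fun k => u (φ k) := by
    rw [Metric.cauchySeq_iff']
    intro ε hε
    obtain ⟨D, hD⟩ : ∃ D, D = |l + b| * |R| := ⟨_, rfl⟩
    have hD0 : 0 ≤ D := by rw [hD]; positivity
    have haε : 0 < a * ε ^ 2 := by positivity
    -- The target `a ε²` is split in halves: `D ‖J (x - y)‖²` takes one, and by `hpar` the two
    -- values of `F`, each below `a ε² / 8`, together take less than the other.
    obtain ⟨N₁, hN₁⟩ := Metric.cauchySeq_iff.mp hcau (√(a * ε ^ 2 / (2 * (D + 1))))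
      (by positivity)
    obtain ⟨N₂, hN₂⟩ := exists_nat_one_div_lt (K := ℝ) (ε := a * ε ^ 2 / 8) (by positivity)
    have hsmall : ∀ k ≥ N₂, F (u (φ k)) (u (φ k)) < a * ε ^ 2 / 8 := by
      intro k hk
      refine (huF (φ k)).trans_le (le_trans ?_ hN₂.le)
      apply one_div_le_one_div_of_le (by positivity)
      have : N₂ ≤ φ k := hk.trans (hφ.id_le k)
      have : (N₂ : ℝ) ≤ φ k := by exact_mod_cast this
      linarith
    refine ⟨max N₁ N₂, fun k hk => ?_⟩
    have hk1 : N₁ ≤ k := (le_max_left _ _).trans hk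
    have hk2 : N₂ ≤ k := (le_max_right _ _).trans hk
    set n := max N₁ N₂
    have h1 := hest _ (W.sub_mem (huW (φ k)) (huW (φ n)))
    have h2 := hpar _ (huW (φ k)) _ (huW (φ n))
    have h3 := hsmall k hk2
    have h4 := hsmall n (le_max_right _ _)
    have h5 := hN₁ k hk1 n (le_max_left _ _)
    rw [dist_eq_norm, ← map_sub] at h5
    have h6 := pow_lt_pow_left₀ h5 (norm_nonneg _) two_ne_zero
    rw [Real.sq_sqrt (by positivity), lt_div_iff₀ (by positivity)] at h6
    rw [← hD] at h1
    rw [dist_eq_norm]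
    refine lt_of_pow_lt_pow_left₀ 2 hε.le ?_
    have h7 : D * ‖J (u (φ k) - u (φ n))‖ ^ 2 ≤ a * ε ^ 2 / 2 := by
      linarith [sq_nonneg ‖J (u (φ k) - u (φ n))‖]
    have : a * ‖u (φ k) - u (φ n)‖ ^ 2 < a * ε ^ 2 := by linarith
    exact lt_of_mul_lt_mul_left this ha.le
  obtain ⟨w, hwW, hw⟩ := cauchySeq_tendsto_of_isComplete hW (fun k => huW (φ k)) hcauchy
  have hdist : Tendsto (fun k => ‖w - u (φ k)‖ ^ 2) atTop (𝓝 0) := by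
    have h1 := (tendsto_const_nhds (x := w)).sub hw
    rw [sub_self] at h1
    simpa using h1.norm.pow 2
  have hMle : ∀ x, M x x ≤ |R| * ‖x‖ ^ 2 := fun x => (h.mass_le x).trans (by
    gcongr
    · exact le_abs_self R
    · exact h.norm_le x)
  have hw0 : w ≠ 0 := by
    rintro rfl
    have h1 : Tendsto (fun k => |R| * ‖0 - u (φ k)‖ ^ 2) atTop (𝓝 0) := by
      simpa using hdist.const_mul |R|
    have h2 : (1 : ℝ) ≤ 0 := ge_of_tendsto' h1 fun k => by
      have := hMle (u (φ k))
      rwa [hu1, ← norm_neg, ← zero_sub] at this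
    norm_num at h2
  -- Continuity of `Q` is not assumed. Writing `w = (w - u) + u`, the inequality `hpar` bounds `F w
  -- w` by diagonal values, and for these the upper bound on `Q` suffices.
  have hFw : F w w = 0 := by
    refine le_antisymm ?_ (hF0 w hwW)
    have h1 : Tendsto (fun k => 2 * (1 / ((φ k : ℝ) + 1)) +
        2 * ((|c| + |l| * |R|) * ‖w - u (φ k)‖ ^ 2)) atTop (𝓝 0) := by
      have h2 := ((tendsto_one_div_add_atTop_nhds_zero_nat (𝕜 := ℝ)).comp
        hφ.tendsto_atTop).const_mul 2
      simpa using h2.add ((hdist.const_mul (|c| + |l| * |R|)).const_mul 2)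
    refine ge_of_tendsto' h1 fun k => ?_
    have hd := W.sub_mem hwW (huW (φ k))
    have h2 := hpar _ hd _ (W.neg_mem (huW (φ k)))
    rw [sub_neg_eq_add, sub_add_cancel] at h2
    simp only [map_neg, LinearMap.neg_apply, neg_neg] at h2
    have h3 : F (w - u (φ k)) (w - u (φ k)) ≤ (|c| + |l| * |R|) * ‖w - u (φ k)‖ ^ 2 := by
      rw [hFdef]
      have h4 := h.upper _ (hWV hd)
      have h5 : c * ‖w - u (φ k)‖ ^ 2 ≤ |c| * ‖w - u (φ k)‖ ^ 2 := by
        gcongr; exact le_abs_self c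
      have h6 : -l * M (w - u (φ k)) (w - u (φ k)) ≤ |l| * (|R| * ‖w - u (φ k)‖ ^ 2) := by
        refine (mul_le_mul_of_nonneg_right (neg_le_abs l) (h.mass_nonneg _)).trans ?_
        gcongr
        exact hMle _
      linarith
    have h7 := (huF (φ k)).le
    linarith
  refine ⟨l, hl, w, hwW, hw0, fun ψ hψ => ?_⟩
  -- A null vector of a semidefinite form is orthogonal to everything: `F (w + tψ) (w + tψ)` is a
  -- nonnegative quadratic in `t` without constant term, so its linear coefficient vanishes.
  have key : ∀ t : ℝ, 0 ≤ F ψ ψ * (t * t) + 2 * F w ψ * t + 0 := by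
    intro t
    have := hF0 _ (W.add_mem hwW (W.smul_mem t hψ))
    simp only [map_add, map_smul, LinearMap.add_apply, LinearMap.smul_apply, smul_eq_mul,
      hFw, hFsymm ψ w] at this
    linarith
  have hd := discrim_le_zero key
  rw [discrim] at hd
  have : F w ψ = 0 := by
    have : F w ψ ^ 2 ≤ 0 := by linarith
    exact pow_eq_zero_iff two_ne_zero |>.mp (le_antisymm this (sq_nonneg _))
  rw [hFdef] at this
  linarith

/-- The solutions `u ∈ V` of `Q[u, φ] = t M[u, φ]` for all `φ ∈ V`. -/
def formEigenspace (Q M : LinearMap.BilinForm ℝ X) (V : Submodule ℝ X) (t : ℝ) :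
    Submodule ℝ X where
  carrier := {u | u ∈ V ∧ ∀ φ ∈ V, Q u φ = t * M u φ}
  add_mem' := by
    rintro u v ⟨hu, hu'⟩ ⟨hv, hv'⟩
    refine ⟨V.add_mem hu hv, fun φ hφ => ?_⟩
    simp only [map_add, LinearMap.add_apply, hu' φ hφ, hv' φ hφ, mul_add]
  zero_mem' := ⟨V.zero_mem, fun φ _ => by simp⟩
  smul_mem' := by
    rintro s u ⟨hu, hu'⟩
    refine ⟨V.smul_mem s hu, fun φ hφ => ?_⟩
    simp only [map_smul, LinearMap.smul_apply, smul_eq_mul, hu' φ hφ]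
    ring

theorem mass_eq_zero_of_ne (h : CoercivePair J Q M V a b c e R) {s t : ℝ} (hst : s ≠ t) {u v : X}
    (hu : u ∈ formEigenspace Q M V s) (hv : v ∈ formEigenspace Q M V t) : M u v = 0 := by
  have h1 := hu.2 v hv.1
  have h2 := hv.2 u hu.1
  rw [h.symmQ v u, h.symmM v u, h1] at h2
  have : (s - t) * M u v = 0 := by linarith
  exact (mul_eq_zero.mp this).resolve_left (sub_ne_zero.mpr hst)

/-- The span of the eigenvectors whose eigenvalues lie in `S`. -/
def spectralSubspace (Q M : LinearMap.BilinForm ℝ X) (V : Submodule ℝ X) (S : Set ℝ) :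
    Submodule ℝ X :=
  ⨆ s : S, formEigenspace Q M V s

theorem spectralSubspace_mono {S T : Set ℝ} (hST : S ⊆ T) :
    spectralSubspace Q M V S ≤ spectralSubspace Q M V T :=
  iSup_le fun s => le_iSup (fun t : T => formEigenspace Q M V t) ⟨s, hST s.2⟩

theorem formEigenspace_le_spectralSubspace {S : Set ℝ} {t : ℝ} (ht : t ∈ S) :
    formEigenspace Q M V t ≤ spectralSubspace Q M V S :=
  le_iSup (fun t : S => formEigenspace Q M V t) ⟨t, ht⟩

theorem spectralSubspace_le {S : Set ℝ} : spectralSubspace Q M V S ≤ V :=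
  iSup_le fun _ _ hu => hu.1

/-- In a decomposition into eigenvectors the cross terms vanish by `M`-orthogonality, so both forms
become sums over the components. -/
theorem spectralSubspace_form_le (h : CoercivePair J Q M V a b c e R) {t : ℝ} {u : X}
    (hu : u ∈ spectralSubspace Q M V (Iic t)) : Q u u ≤ t * M u u := by
  obtain ⟨f, hf, rfl⟩ := (Submodule.mem_iSup_iff_exists_finsupp _ _).mp hu
  have hV : (f.sum fun _ x => x) ∈ V := spectralSubspace_le hu
  have hM : ∀ s ∈ f.support, M (f s) (f.sum fun _ x => x) = M (f s) (f s) := by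
    intro s hs
    rw [Finsupp.sum, map_sum]
    refine Finset.sum_eq_single_of_mem s hs fun r _ hr => ?_
    exact h.mass_eq_zero_of_ne (fun h0 => hr (Subtype.ext h0.symm)) (hf s) (hf r)
  have hsum : ∀ B : LinearMap.BilinForm ℝ X, ∀ y,
      B (f.sum fun _ x => x) y = ∑ s ∈ f.support, B (f s) y := fun B y => by
    rw [← LinearMap.sum_apply, ← map_sum]
    rfl
  have e1 : Q (f.sum fun _ x => x) (f.sum fun _ x => x) = ∑ s ∈ f.support, s * M (f s) (f s) := by
    rw [hsum]
    refine Finset.sum_congr rfl fun s hs => ?_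
    rw [(hf s).2 _ hV, hM s hs]
  have e2 : M (f.sum fun _ x => x) (f.sum fun _ x => x) = ∑ s ∈ f.support, M (f s) (f s) := by
    rw [hsum]
    exact Finset.sum_congr rfl hM
  rw [e1, e2, Finset.mul_sum]
  exact Finset.sum_le_sum fun s _ => mul_le_mul_of_nonneg_right s.2 (h.mass_nonneg _)

/-- A common vector `u` is `M`-orthogonal to all of the first space, hence to itself. -/
theorem disjoint_spectralSubspace (h : CoercivePair J Q M V a b c e R) {S : Set ℝ} {t : ℝ}
    (ht : t ∉ S) : Disjoint (spectralSubspace Q M V S) (formEigenspace Q M V t) := by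
  rw [Submodule.disjoint_def]
  intro u hu hut
  have hle : spectralSubspace Q M V S ≤ LinearMap.ker (M u) := iSup_le fun s v hv => by
    rw [LinearMap.mem_ker]
    exact h.mass_eq_zero_of_ne (fun h0 : t = s => ht (by rw [h0]; exact s.2)) hut hv
  exact h.eq_zero_of_mass (hle hu)

theorem finiteDimensional_spectralSubspace (h : CoercivePair J Q M V a b c e R)
    (hJ : IsCompactMapOn J V) (t : ℝ) :
    FiniteDimensional ℝ (spectralSubspace Q M V (Iic t)) := by
  obtain ⟨m, hm⟩ := h.exists_rank_le hJ t
  exact Module.rank_lt_aleph0_iff.mp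
    ((hm _ spectralSubspace_le fun u hu => h.spectralSubspace_form_le hu).trans_lt
      (Cardinal.natCast_lt_aleph0))

/-- On the complement of the eigenvectors with eigenvalue at most `t` the quotient exceeds `t`
uniformly. -/
theorem exists_gap (h : CoercivePair J Q M V a b c e R) (hJ : IsCompactMapOn J V)
    (hV : IsComplete (V : Set X)) (t : ℝ) :
    ∃ l > t, ∀ u ∈ h.massCompl (spectralSubspace Q M V (Iic t)), l * M u u ≤ Q u u := by
  have := h.finiteDimensional_spectralSubspace hJ t
  obtain ⟨G, hG⟩ : ∃ G, G = spectralSubspace Q M V (Iic t) := ⟨_, rfl⟩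
  rw [← hG] at this ⊢
  have hGV : G ≤ V := hG ▸ spectralSubspace_le
  have hEG : ∀ s ≤ t, formEigenspace Q M V s ≤ G := fun s hs =>
    hG ▸ formEigenspace_le_spectralSubspace (S := Iic t) hs
  by_cases hne : h.massCompl G = ⊥
  -- If the complement is zero, every `l` works.
  · refine ⟨t + 1, lt_add_one t, fun u hu => ?_⟩
    rw [hne, Submodule.mem_bot] at hu
    simp [hu]
  have hWV : h.massCompl G ≤ V := fun u hu => hu.1
  obtain ⟨l, hl, w, hw, hw0, hwl⟩ :=
    h.exists_minimizer hJ hWV (h.isComplete_massCompl hV G) hne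
  refine ⟨l, ?_, hl⟩
  by_contra! hlt
  -- Each eigenvector `v` in `G` satisfies `Q v w = s * M v w = 0`. So the equation for `w`, known
  -- on the complement only, extends to `V`; then `l ≤ t` would put `w` both in `G` and in its
  -- complement.
  have hQG : G ≤ LinearMap.ker (Q w) := by
    rw [hG]
    refine iSup_le fun s v hv => ?_
    rw [LinearMap.mem_ker, h.symmQ, hv.2 w hw.1, h.symmM, hw.2 v (hEG s s.2 hv), mul_zero]
  have hwE : w ∈ formEigenspace Q M V l := by
    refine ⟨hw.1, fun φ hφ => ?_⟩
    obtain ⟨g, hg, hφg⟩ := h.exists_sub_mem_massCompl hGV hφ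
    have h1 := hwl _ hφg
    rw [map_sub, map_sub, hw.2 g hg, LinearMap.mem_ker.mp (hQG hg)] at h1
    linarith
  exact hw0 (h.eq_zero_of_mass (hw.2 w (hEG l hlt hwE)))

/-- If the dimension is at least `n`, part of the spectral subspace is a trial space. If it is
smaller, every trial space of dimension `n` meets the complement, where the quotient is at least
some `l > t`. An `s` strictly between `t` and `l` is used because the infimum is not known to be
attained. -/
theorem minMax_le_iff (h : CoercivePair J Q M V a b c e R) (hJ : IsCompactMapOn J V)
    (hV : IsComplete (V : Set X)) {n : ℕ} (hn1 : 1 ≤ n)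
    (hn : (n : Cardinal) ≤ Module.rank ℝ V) (t : ℝ) :
    minMax Q M V n ≤ t ↔ n ≤ Module.finrank ℝ (spectralSubspace Q M V (Iic t)) := by
  have := h.finiteDimensional_spectralSubspace hJ t
  constructor
  · intro hle
    by_contra! hlt
    obtain ⟨l, hl, hgap⟩ := h.exists_gap hJ hV t
    obtain ⟨s, hts, hsl⟩ := exists_between hl
    obtain ⟨E, hEV, hE, hQ⟩ := h.exists_of_minMax_lt hn (hle.trans_lt hts)
    have := finiteDimensional_of_rank_eq hE
    rw [← Module.finrank_eq_of_rank_eq hE] at hlt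
    obtain ⟨u, huE, hu0, huW⟩ := h.exists_mem_massCompl hEV hlt
    have h1 := hQ u huE
    have h2 := hgap u huW
    have h3 := mul_lt_mul_of_pos_right hsl (h.mass_pos hu0)
    linarith
  · intro hle
    have hle' : (n : Cardinal) ≤ Module.rank ℝ (spectralSubspace Q M V (Iic t)) := by
      rw [← Module.finrank_eq_rank]
      exact_mod_cast hle
    obtain ⟨E, hEG, hE⟩ := Submodule.exists_le_rank_eq hle'
    exact h.minMax_le hn1 (hEG.trans spectralSubspace_le) hE fun u hu =>
      h.spectralSubspace_form_le (hEG hu)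

/-- Only finitely many eigenvalues accumulate below `t`. -/
theorem exists_spectralSubspace_Iio_eq (h : CoercivePair J Q M V a b c e R)
    (hJ : IsCompactMapOn J V) (t : ℝ) :
    ∃ s₀ < t, ∀ s, s₀ ≤ s → s < t →
      spectralSubspace Q M V (Iio t) = spectralSubspace Q M V (Iic s) := by
  have := h.finiteDimensional_spectralSubspace hJ t
  have hfd : FiniteDimensional ℝ (spectralSubspace Q M V (Iio t)) :=
    Submodule.finiteDimensional_of_le (spectralSubspace_mono Iio_subset_Iic_self)
  -- A finitely generated subspace is a compact element of the lattice, so a directed supremum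
  -- covering it already covers it at some `s < t`.
  have hcomp := (Submodule.fg_iff_compact _).mp ((Submodule.fg_iff_finiteDimensional _).mpr hfd)
  have hdir : Directed (· ≤ ·) fun s : Iio t => spectralSubspace Q M V (Iic (s : ℝ)) :=
    Monotone.directed_le fun r s hrs => spectralSubspace_mono (Iic_subset_Iic.mpr hrs)
  have hne : Nonempty (Iio t) := ⟨⟨t - 1, sub_one_lt t⟩⟩
  rw [CompleteLattice.isCompactElement_iff_le_of_directed_sSup_le] at hcomp
  obtain ⟨_, ⟨s, rfl⟩, hs⟩ := hcomp (range fun s : Iio t => spectralSubspace Q M V (Iic (s : ℝ)))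
    (range_nonempty _) hdir.directedOn_range (by
      rw [sSup_range]
      exact iSup_le fun s => (formEigenspace_le_spectralSubspace self_mem_Iic).trans
        (le_iSup (fun s : Iio t => spectralSubspace Q M V (Iic (s : ℝ))) s))
  refine ⟨s, s.2, fun r hr hrt => le_antisymm (hs.trans ?_) ?_⟩
  · exact spectralSubspace_mono (Iic_subset_Iic.mpr hr)
  · exact spectralSubspace_mono (Iic_subset_Iio.mpr hrt)

/-- The strict version reduces to `minMax_le_iff`, since no eigenvalue lies in an interval just
below `t`. -/
theorem minMax_lt_iff (h : CoercivePair J Q M V a b c e R) (hJ : IsCompactMapOn J V)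
    (hV : IsComplete (V : Set X)) {n : ℕ} (hn1 : 1 ≤ n)
    (hn : (n : Cardinal) ≤ Module.rank ℝ V) (t : ℝ) :
    minMax Q M V n < t ↔ n ≤ Module.finrank ℝ (spectralSubspace Q M V (Iio t)) := by
  obtain ⟨s₀, hs₀, hs⟩ := h.exists_spectralSubspace_Iio_eq hJ t
  constructor
  · intro hlt
    rw [hs _ (le_max_left s₀ (minMax Q M V n)) (max_lt hs₀ hlt), ← h.minMax_le_iff hJ hV hn1 hn]
    exact le_max_right _ _
  · intro hle
    rw [hs s₀ le_rfl hs₀, ← h.minMax_le_iff hJ hV hn1 hn] at hle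
    exact hle.trans_lt hs₀

theorem finrank_spectralSubspace_Iic (h : CoercivePair J Q M V a b c e R)
    (hJ : IsCompactMapOn J V) (t : ℝ) :
    FiniteDimensional ℝ (formEigenspace Q M V t) ∧
    Module.finrank ℝ (spectralSubspace Q M V (Iic t)) =
      Module.finrank ℝ (spectralSubspace Q M V (Iio t)) +
        Module.finrank ℝ (formEigenspace Q M V t) := by
  have := h.finiteDimensional_spectralSubspace hJ t
  have : FiniteDimensional ℝ (spectralSubspace Q M V (Iio t)) :=
    Submodule.finiteDimensional_of_le (spectralSubspace_mono Iio_subset_Iic_self)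
  have : FiniteDimensional ℝ (formEigenspace Q M V t) :=
    Submodule.finiteDimensional_of_le (formEigenspace_le_spectralSubspace self_mem_Iic)
  refine ⟨this, ?_⟩
  have hsup : spectralSubspace Q M V (Iic t) =
      spectralSubspace Q M V (Iio t) ⊔ formEigenspace Q M V t := by
    refine le_antisymm (iSup_le fun s => ?_) (sup_le ?_ ?_)
    · rcases (show (s : ℝ) ≤ t from s.2).lt_or_eq with h0 | h0
      · exact (formEigenspace_le_spectralSubspace (S := Iio t) h0).trans le_sup_left
      · rw [h0]; exact le_sup_right
    · exact spectralSubspace_mono Iio_subset_Iic_self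
    · exact formEigenspace_le_spectralSubspace self_mem_Iic
  have h1 := Submodule.finrank_sup_add_finrank_inf_eq (spectralSubspace Q M V (Iio t))
    (formEigenspace Q M V t)
  rw [(h.disjoint_spectralSubspace (S := Iio t) (lt_irrefl t)).eq_bot, finrank_bot, add_zero,
    ← hsup] at h1
  exact h1

theorem finite_setOf_minMax_le (h : CoercivePair J Q M V a b c e R) (hJ : IsCompactMapOn J V)
    (t : ℝ) :
    {n : ℕ | (1 ≤ n ∧ (n : Cardinal) ≤ Module.rank ℝ V) ∧ minMax Q M V n ≤ t}.Finite := by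
  -- The bound `t + 1` leaves room for trial spaces that only nearly attain the infimum.
  obtain ⟨m, hm⟩ := h.exists_rank_le hJ (t + 1)
  refine (finite_Iic m).subset ?_
  rintro n ⟨⟨-, hn⟩, hnt⟩
  obtain ⟨E, hEV, hE, hQ⟩ := h.exists_of_minMax_lt hn (hnt.trans_lt (lt_add_one t))
  have := hm E hEV hQ
  rw [hE] at this
  exact_mod_cast this

/-- The indices with value `t` form the interval between the dimensions of the spectral subspaces
below `t` and up to `t`. Here `X` lives in `Type` so that both cardinals lie in one universe. -/
theorem rank_formEigenspace {X : Type} [NormedAddCommGroup X] [NormedSpace ℝ X] {J : X →ₗ[ℝ] H}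
    {Q M : LinearMap.BilinForm ℝ X} {V : Submodule ℝ X}
    (h : CoercivePair J Q M V a b c e R) (hJ : IsCompactMapOn J V)
    (hV : IsComplete (V : Set X)) (t : ℝ) :
    Module.rank ℝ (formEigenspace Q M V t) = Cardinal.mk {n : ℕ //
      (1 ≤ n ∧ (n : Cardinal) ≤ Module.rank ℝ V) ∧ minMax Q M V n = t} := by
  obtain ⟨hfd, hsum⟩ := h.finrank_spectralSubspace_Iic hJ t
  have hfdG := h.finiteDimensional_spectralSubspace hJ t
  have hset : ∀ n : ℕ, ((1 ≤ n ∧ (n : Cardinal) ≤ Module.rank ℝ V) ∧ minMax Q M V n = t) ↔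
      n ∈ Finset.Ioc (Module.finrank ℝ (spectralSubspace Q M V (Iio t)))
        (Module.finrank ℝ (spectralSubspace Q M V (Iic t))) := by
    intro n
    rw [Finset.mem_Ioc]
    constructor
    · rintro ⟨⟨hn1, hn⟩, hnt⟩
      have h1 := h.minMax_le_iff hJ hV hn1 hn t
      have h2 := h.minMax_lt_iff hJ hV hn1 hn t
      rw [hnt] at h1 h2
      exact ⟨not_le.mp fun h3 => lt_irrefl t (h2.mpr h3), h1.mp le_rfl⟩
    · rintro ⟨hlt, hle⟩
      have hn1 : 1 ≤ n := by omega
      have hn : (n : Cardinal) ≤ Module.rank ℝ V := by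
        refine le_trans ?_ (Submodule.rank_mono (spectralSubspace_le (Q := Q) (M := M) (S := Iic t)))
        rw [← Module.finrank_eq_rank]
        exact_mod_cast hle
      refine ⟨⟨hn1, hn⟩, le_antisymm ((h.minMax_le_iff hJ hV hn1 hn t).mpr hle) ?_⟩
      by_contra! h3
      exact hlt.not_ge ((h.minMax_lt_iff hJ hV hn1 hn t).mp h3)
  rw [Cardinal.mk_congr (Equiv.subtypeEquivRight hset), Cardinal.mk_coe_finset, Nat.card_Ioc,
    hsum, Nat.add_sub_cancel_left, Module.finrank_eq_rank]

end CoercivePair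

/-! ### The energy and mass forms as bilinear forms -/

section Concrete

variable {N : ℕ} {Ω : Opens (Eucl N)} {m : ℕ}

theorem energyForm_comm {A : (Fin N → ℕ) → (Fin N → ℕ) → LpOn Ω ∞}
    (hA : ∀ α β : Fin N → ℕ, miOrder α ≤ m → miOrder β ≤ m → A α β = A β α)
    (u v : Sobolev Ω m) : energyForm A u v = energyForm A v u := by
  unfold energyForm
  congr 1
  funext x
  rw [Finset.sum_comm]
  refine Finset.sum_congr rfl fun α hα => Finset.sum_congr rfl fun β hβ => ?_
  rw [hA β α (mem_miLE.mp hβ) (mem_miLE.mp hα)]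
  ring

theorem massForm_comm (ρ : LpOn Ω ∞) (u v : Sobolev Ω m) : massForm ρ u v = massForm ρ v u := by
  unfold massForm
  simp only [mul_comm (u.toL2 _)]

/-- The energy form as a bilinear form. -/
def energyBilin (A : (Fin N → ℕ) → (Fin N → ℕ) → LpOn Ω ∞)
    (hA : ∀ α β : Fin N → ℕ, miOrder α ≤ m → miOrder β ≤ m → A α β = A β α) :
    LinearMap.BilinForm ℝ (Sobolev Ω m) :=
  LinearMap.mk₂ ℝ (energyForm A) (energyForm_add_left A) (energyForm_smul_left A)
    (fun u v w => by
      rw [energyForm_comm hA, energyForm_add_left, energyForm_comm hA v, energyForm_comm hA w])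
    (fun t u v => by
      rw [energyForm_comm hA, energyForm_smul_left, energyForm_comm hA v]; rfl)

/-- The mass form as a bilinear form. -/
def massBilin (ρ : LpOn Ω ∞) : LinearMap.BilinForm ℝ (Sobolev Ω m) :=
  LinearMap.mk₂ ℝ (massForm ρ) (massForm_add_left ρ) (massForm_smul_left ρ)
    (fun u v w => by
      rw [massForm_comm, massForm_add_left, massForm_comm ρ v, massForm_comm ρ w])
    (fun t u v => by
      rw [massForm_comm, massForm_smul_left, massForm_comm ρ v]; rfl)

theorem massBilin_apply (ρ : LpOn Ω ∞) (u v : Sobolev Ω m) :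
    massBilin ρ u v = massForm ρ u v := rfl

/-- The pairing `∫ f g ρ` on `L²(Ω)`, with `ρ ∈ L^∞(Ω)`. -/
def weightedInner (ρ : LpOn Ω ∞) (f g : LpOn Ω 2) : ℝ := inner ℝ f (ρ • g : LpOn Ω 2)

theorem weightedInner_eq (ρ : LpOn Ω ∞) (f g : LpOn Ω 2) :
    weightedInner ρ f g = ∫ x in (Ω : Set (Eucl N)), f x * g x * ρ x := by
  rw [weightedInner, L2.inner_def]
  apply integral_congr_ae
  filter_upwards [Lp.coeFn_lpSMul (r := 2) ρ g] with x hx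
  rw [hx]
  simp [mul_comm, mul_left_comm]

theorem massForm_eq (ρ : LpOn Ω ∞) (u v : Sobolev Ω m) :
    massForm ρ u v = weightedInner ρ u.toL2 v.toL2 := (weightedInner_eq ρ _ _).symm

theorem abs_weightedInner_le (ρ : LpOn Ω ∞) (f g : LpOn Ω 2) :
    |weightedInner ρ f g| ≤ ‖ρ‖ * ‖f‖ * ‖g‖ := by
  calc |weightedInner ρ f g| ≤ ‖f‖ * ‖(ρ • g : LpOn Ω 2)‖ := abs_real_inner_le_norm _ _
    _ ≤ ‖f‖ * (‖ρ‖ * ‖g‖) := by gcongr; exact Lp.norm_smul_le ρ g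
    _ = _ := by ring

theorem weightedInner_sub (ρ σ : LpOn Ω ∞) (f g : LpOn Ω 2) :
    weightedInner (ρ - σ) f g = weightedInner ρ f g - weightedInner σ f g := by
  rw [weightedInner, weightedInner, weightedInner, ← inner_sub_right, sub_eq_add_neg, Lp.smul_add,
    Lp.neg_smul, ← sub_eq_add_neg]

/-- The analogue of x² − y² = (x − y)x + y(x − y); it makes f ↦ ∫f²ρ Lipschitz on bounded sets, with
a constant proportional to `‖ρ‖`. -/
theorem weightedInner_self_sub (ρ : LpOn Ω ∞) (f g : LpOn Ω 2) :
    weightedInner ρ f f - weightedInner ρ g g =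
      weightedInner ρ (f - g) f + weightedInner ρ g (f - g) := by
  simp only [weightedInner, sub_eq_add_neg, Lp.add_smul, Lp.smul_neg, inner_add_left,
    inner_add_right, inner_neg_left, inner_neg_right]
  ring

theorem le_weightedInner {ρ : LpOn Ω ∞} {ε : ℝ} (hε : ∀ᵐ x ∂(volOn Ω), ε ≤ ρ x)
    (f : LpOn Ω 2) : ε * ‖f‖ ^ 2 ≤ weightedInner ρ f f := by
  rw [← real_inner_self_eq_norm_sq, L2.inner_def, weightedInner_eq, ← integral_const_mul]
  refine integral_mono_ae ((L2.integrable_inner f f).const_mul ε) (integrable_mass ρ f f) ?_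
  filter_upwards [hε] with x hx
  simp only [real_inner_self_eq_norm_sq, Real.norm_eq_abs, sq_abs]
  nlinarith [sq_nonneg (f x)]

theorem Sobolev.toL2_injective : Function.Injective (toL2 : Sobolev Ω m →ₗ[ℝ] LpOn Ω 2) :=
  fun _ _ h => Subtype.ext h

theorem Sobolev.norm_toL2_le (u : Sobolev Ω m) : ‖toL2 u‖ ≤ ‖u‖ := by
  rw [norm_eq]
  apply Real.le_sqrt_of_sq_le
  exact le_add_of_nonneg_right (Finset.sum_nonneg fun _ _ => sq_nonneg _)

theorem isCompactMapOn_toL2 {V : Submodule ℝ (Sobolev Ω m)}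
    (hV : IsCompactOperator fun u : V => Sobolev.toL2 (u : Sobolev Ω m)) :
    IsCompactMapOn (Sobolev.toL2 : Sobolev Ω m →ₗ[ℝ] LpOn Ω 2) V := by
  obtain ⟨K, hK, hK0⟩ := hV
  obtain ⟨r, hr, hrK⟩ := Metric.mem_nhds_iff.mp hK0
  refine ⟨K, hK, r / 2, half_pos hr, fun u hu hur => ?_⟩
  have : (⟨u, hu⟩ : V) ∈ Metric.ball (0 : V) r := by
    rw [mem_ball_zero_iff]
    exact lt_of_le_of_lt hur (half_lt_self hr)
  exact hrK this

theorem coercivePair_energy_mass {A : (Fin N → ℕ) → (Fin N → ℕ) → LpOn Ω ∞}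
    (hA : ∀ α β : Fin N → ℕ, miOrder α ≤ m → miOrder β ≤ m → A α β = A β α)
    {V : Submodule ℝ (Sobolev Ω m)} {ρ : LpOn Ω ∞} {ε : ℝ} (hε : 0 < ε)
    (hρ : ∀ᵐ x ∂(volOn Ω), ε ≤ ρ x) {a b c : ℝ} (ha : 0 < a)
    (hgarding : ∀ u ∈ V, a * ‖u‖ ^ 2 ≤ energyForm A u u + b * massForm ρ u u)
    (hupper : ∀ u ∈ V, energyForm A u u ≤ c * ‖u‖ ^ 2) :
    CoercivePair (Sobolev.toL2 : Sobolev Ω m →ₗ[ℝ] LpOn Ω 2) (energyBilin A hA) (massBilin ρ) V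
      a b c ε ‖ρ‖ where
  symmQ := energyForm_comm hA
  symmM := massForm_comm ρ
  a_pos := ha
  e_pos := hε
  coercive := hgarding
  upper := hupper
  lowerM u := (le_weightedInner hρ _).trans_eq (massForm_eq ρ u u).symm
  boundM u v := by
    have := abs_weightedInner_le ρ u.toL2 v.toL2
    rwa [← massForm_eq] at this
  inj := Sobolev.toL2_injective
  norm_le := Sobolev.norm_toL2_le

/-! ### Weak* continuity -/

/-- The map `ρ ↦ ∫ f² ρ` is weak* continuous. -/
theorem continuous_weightedInner_self (f : LpOn Ω 2) :
    @Continuous _ _ (weakStarTopology Ω) inferInstance fun ρ : LpOn Ω ∞ =>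
      weightedInner ρ f f := by
  have hf : MemLp (fun x => f x * f x) 1 (volOn Ω) :=
    memLp_one_iff_integrable.mpr (MemLp.integrable_mul (p := 2) (q := 2) (Lp.memLp f) (Lp.memLp f))
  have heq : (fun ρ : LpOn Ω ∞ => weightedInner ρ f f) =
      (fun F : LpOn Ω 1 → ℝ => F hf.toLp) ∘
        fun ρ (g : LpOn Ω 1) => ∫ x in (Ω : Set (Eucl N)), ρ x * g x := by
    funext ρ
    rw [weightedInner_eq]
    apply integral_congr_ae
    filter_upwards [hf.coeFn_toLp] with x hx
    rw [hx]; ring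
  rw [heq]
  let _ := weakStarTopology Ω
  exact (continuous_apply _).comp continuous_induced_dom

/-- On bounded sets, weak* convergence of the densities makes the mass forms converge uniformly
on the unit ball of `V`. -/
theorem eventually_mass_close {V : Submodule ℝ (Sobolev Ω m)}
    (hJ : IsCompactMapOn (Sobolev.toL2 : Sobolev Ω m →ₗ[ℝ] LpOn Ω 2) V) {C : Set (LpOn Ω ∞)}
    (hC : Bornology.IsBounded C) {ρ₀ : LpOn Ω ∞} (hρ₀ : ρ₀ ∈ C) {η : ℝ} (hη : 0 < η) :
    ∀ᶠ ρ in @nhdsWithin _ (weakStarTopology Ω) ρ₀ C,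
      ∀ u ∈ V, |massBilin ρ u u - massBilin ρ₀ u u| ≤ η * ‖u‖ ^ 2 := by
  simp only [massBilin_apply]
  obtain ⟨K, hK, r, hr, hrK⟩ := hJ
  obtain ⟨R, hR⟩ := hC.exists_norm_le
  obtain ⟨L, hL⟩ := hK.isBounded.exists_norm_le
  have hηr : 0 < η * r ^ 2 := by positivity
  -- `2 |R|` bounds `‖ρ - ρ₀‖`, while `|L|` and `|L| + 1` bound a point of `K` and its net point,
  -- the latter because `δ ≤ 1`. Passing to the net costs at most `P * δ`, half of the allowed
  -- error.
  set P := 2 * |R| * (2 * |L| + 1) with hP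
  have hP0 : 0 ≤ P := by positivity
  set δ := min 1 (η * r ^ 2 / (2 * (P + 1)))
  have hδ : 0 < δ := by positivity
  have hPδ : P * δ ≤ η * r ^ 2 / 2 := by
    have h1 : δ ≤ η * r ^ 2 / (2 * (P + 1)) := min_le_right _ _
    rw [le_div_iff₀ (by positivity)] at h1
    linarith
  obtain ⟨t, htfin, ht⟩ := Metric.totallyBounded_iff.mp hK.totallyBounded δ hδ
  have hev : ∀ᶠ ρ in @nhdsWithin _ (weakStarTopology Ω) ρ₀ C, ∀ v ∈ t,
      dist (weightedInner ρ v v) (weightedInner ρ₀ v v) < η * r ^ 2 / 2 := by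
    rw [Filter.eventually_all_finite htfin]
    intro v _
    let _ := weakStarTopology Ω
    have := (continuous_weightedInner_self v).continuousWithinAt (s := C) (x := ρ₀)
    exact Metric.tendsto_nhds.mp this _ (half_pos hηr)
  have hmem : ∀ᶠ ρ in @nhdsWithin _ (weakStarTopology Ω) ρ₀ C, ρ ∈ C := by
    let _ := weakStarTopology Ω
    exact eventually_mem_nhdsWithin
  filter_upwards [hev, hmem] with ρ hρ hρC
  have hσ : ‖ρ - ρ₀‖ ≤ 2 * |R| := by
    have h1 := hR ρ hρC
    have h2 := hR ρ₀ hρ₀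
    have h3 := norm_sub_le ρ ρ₀
    linarith [le_abs_self R]
  have hK' : ∀ w ∈ K, |weightedInner (ρ - ρ₀) w w| ≤ η * r ^ 2 := by
    intro w hw
    obtain ⟨v, hvt, hwv⟩ := mem_iUnion₂.mp (ht hw)
    rw [Metric.mem_ball, dist_eq_norm] at hwv
    have h1 : |weightedInner (ρ - ρ₀) v v| ≤ η * r ^ 2 / 2 := by
      rw [weightedInner_sub]; exact (hρ v hvt).le
    have hwL : ‖w‖ ≤ |L| := (hL w hw).trans (le_abs_self L)
    have hvL : ‖v‖ ≤ |L| + 1 := by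
      have h2 : ‖v‖ ≤ ‖w‖ + ‖w - v‖ := by
        rw [norm_sub_rev]; exact norm_le_norm_add_norm_sub' v w
      have h3 : δ ≤ 1 := min_le_left _ _
      linarith
    have h2 := abs_weightedInner_le (ρ - ρ₀) (w - v) w
    have h3 := abs_weightedInner_le (ρ - ρ₀) v (w - v)
    have h4 : ‖ρ - ρ₀‖ * ‖w - v‖ * ‖w‖ ≤ 2 * |R| * δ * |L| := by gcongr
    have h5 : ‖ρ - ρ₀‖ * ‖v‖ * ‖w - v‖ ≤ 2 * |R| * (|L| + 1) * δ := by gcongr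
    have h6 : weightedInner (ρ - ρ₀) w w = weightedInner (ρ - ρ₀) v v +
        (weightedInner (ρ - ρ₀) (w - v) w + weightedInner (ρ - ρ₀) v (w - v)) := by
      rw [← weightedInner_self_sub]; ring
    rw [h6]
    have h7 := abs_add_le (weightedInner (ρ - ρ₀) v v)
      (weightedInner (ρ - ρ₀) (w - v) w + weightedInner (ρ - ρ₀) v (w - v))
    have h8 := abs_add_le (weightedInner (ρ - ρ₀) (w - v) w) (weightedInner (ρ - ρ₀) v (w - v))
    have h9 : 2 * |R| * δ * |L| + 2 * |R| * (|L| + 1) * δ = P * δ := by rw [hP]; ring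
    linarith
  intro u hu
  rcases eq_or_ne u 0 with rfl | hu0
  · rw [massForm_eq, massForm_eq, ← weightedInner_sub]
    have := abs_weightedInner_le (ρ - ρ₀) (Sobolev.toL2 (0 : Sobolev Ω m))
      (Sobolev.toL2 (0 : Sobolev Ω m))
    simpa using this
  have hn : 0 < ‖u‖ := norm_pos_iff.mpr hu0
  -- Both sides are quadratic in `u`, so it is enough to compare the masses on the sphere of radius
  -- `r`.
  have h1 := hK' _ (hrK ((r / ‖u‖) • u) (V.smul_mem _ hu) (by
    rw [norm_smul, Real.norm_of_nonneg (by positivity), div_mul_cancel₀ _ hn.ne']))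
  have h2 : weightedInner (ρ - ρ₀) (Sobolev.toL2 ((r / ‖u‖) • u)) (Sobolev.toL2 ((r / ‖u‖) • u)) =
      (r / ‖u‖) ^ 2 * (massForm ρ u u - massForm ρ₀ u u) := by
    rw [← massForm_eq, massForm_smul_left, massForm_comm, massForm_smul_left, massForm_eq,
      weightedInner_sub, ← massForm_eq, ← massForm_eq]
    ring
  rw [h2, abs_mul, abs_of_nonneg (sq_nonneg _), div_pow, div_mul_eq_mul_div,
    div_le_iff₀ (by positivity)] at h1
  have hr2 : 0 < r ^ 2 := by positivity
  nlinarith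

/-- The comparison of masses is symmetric: from `ρ` to `ρ₀` it gives lower semicontinuity, from `ρ₀`
to `ρ` upper semicontinuity. -/
theorem continuousOn_minMax {Q : LinearMap.BilinForm ℝ (Sobolev Ω m)}
    {V : Submodule ℝ (Sobolev Ω m)}
    (hJ : IsCompactMapOn (Sobolev.toL2 : Sobolev Ω m →ₗ[ℝ] LpOn Ω 2) V) {C : Set (LpOn Ω ∞)}
    (hC : Bornology.IsBounded C) {a b c : ℝ} (ha : 0 < a)
    (hpair : ∀ ρ ∈ C, ∃ ε : ℝ, CoercivePair (Sobolev.toL2 : Sobolev Ω m →ₗ[ℝ] LpOn Ω 2)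
      Q (massBilin ρ) V a b c ε ‖ρ‖) {n : ℕ} (hn1 : 1 ≤ n)
    (hn : (n : Cardinal) ≤ Module.rank ℝ V) :
    @ContinuousOn (LpOn Ω ∞) ℝ (weakStarTopology Ω) inferInstance
      (fun ρ => minMax Q (massBilin ρ) V n) C := by
  intro ρ₀ hρ₀
  obtain ⟨ε₀, h₀⟩ := hpair ρ₀ hρ₀
  have hmem : ∀ᶠ ρ in @nhdsWithin _ (weakStarTopology Ω) ρ₀ C, ρ ∈ C := by
    let _ := weakStarTopology Ω
    exact eventually_mem_nhdsWithin
  refine tendsto_order.mpr ⟨fun x hx => ?_, fun x hx => ?_⟩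
  · obtain ⟨s, hxs, hs⟩ := exists_between hx
    obtain ⟨η, hη, hclose⟩ := CoercivePair.exists_closeness
      (J := (Sobolev.toL2 : Sobolev Ω m →ₗ[ℝ] LpOn Ω 2)) (V := V) (b := b) (c := c) ha
      hn1 hn s (half_pos (sub_pos.mpr hs))
    filter_upwards [eventually_mass_close hJ hC hρ₀ hη, hmem] with ρ hρ hρC
    obtain ⟨ε, h⟩ := hpair ρ hρC
    refine hxs.trans_le ?_
    -- A value below `s` at `ρ` would place the value at `ρ₀` at most halfway between `s` and
    -- itself.
    by_contra! hlt
    have h1 := hclose Q (massBilin ρ) (massBilin ρ₀) _ _ _ _ h h₀ hρ hlt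
    linarith
  · obtain ⟨s, hs, hsx⟩ := exists_between hx
    obtain ⟨η, hη, hclose⟩ := CoercivePair.exists_closeness
      (J := (Sobolev.toL2 : Sobolev Ω m →ₗ[ℝ] LpOn Ω 2)) (V := V) (b := b) (c := c) ha
      hn1 hn s (half_pos (sub_pos.mpr hsx))
    filter_upwards [eventually_mass_close hJ hC hρ₀ hη, hmem] with ρ hρ hρC
    obtain ⟨ε, h⟩ := hpair ρ hρC
    have h1 := hclose Q (massBilin ρ₀) (massBilin ρ) _ _ _ _ h₀ h
      (fun u hu => by rw [abs_sub_comm]; exact hρ u hu) hs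
    linarith

end Concrete

end

/-! ### The theorem for the Sobolev forms -/

theorem theorem3p1 {N m : ℕ} (hm : 1 ≤ m) (Ω : Opens (Eucl N))
    (A : (Fin N → ℕ) → (Fin N → ℕ) → LpOn Ω ∞)
    (hA : ∀ α β : Fin N → ℕ, miOrder α ≤ m → miOrder β ≤ m → A α β = A β α)
    (V : Submodule ℝ (Sobolev Ω m))
    (hVclosed : IsClosed (V : Set (Sobolev Ω m)))
    (hVcompact : IsCompactOperator fun u : V => Sobolev.toL2 (u : Sobolev Ω m))
    (C : Set (LpOn Ω ∞)) (hCR : C ⊆ densities Ω) (hCbdd : Bornology.IsBounded C)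
    (a b c : ℝ) (ha : 0 < a) (hb : 0 < b) (hc : 0 < c)
    (hgarding : ∀ ρ ∈ C, ∀ u ∈ V, a * ‖u‖ ^ 2 ≤ energyForm A u u + b * massForm ρ u u)
    (hupper : ∀ u ∈ V, energyForm A u u ≤ c * ‖u‖ ^ 2) :
    (∀ n ∈ indexSet V,
      @ContinuousOn (LpOn Ω ∞) ℝ (weakStarTopology Ω) inferInstance (lam A V n) C) ∧
    (IsComplete (V : Set (Sobolev Ω m)) →
      ∀ ρ ∈ C, IsEigenvalueSequence A V ρ (fun n => lam A V n ρ)) := by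
  have hJ := isCompactMapOn_toL2 hVcompact
  have hpair : ∀ ρ ∈ C, ∃ ε : ℝ, CoercivePair (Sobolev.toL2 : Sobolev Ω m →ₗ[ℝ] LpOn Ω 2)
      (energyBilin A hA) (massBilin ρ) V a b c ε ‖ρ‖ := fun ρ hρ => by
    obtain ⟨ε, hε, hερ⟩ := hCR hρ
    exact ⟨ε, coercivePair_energy_mass hA hε hερ ha (hgarding ρ hρ) hupper⟩
  -- `lam` and `weakEigenspace` unfold to `minMax` and `formEigenspace` of the bilinear forms, so
  -- the abstract results apply definitionally.
  refine ⟨fun n hn => continuousOn_minMax hJ hCbdd ha hpair hn.1 hn.2, fun hV ρ hρ => ?_⟩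
  obtain ⟨ε, h⟩ := hpair ρ hρ
  exact
    { mono := fun k hk n hn hkn => h.minMax_mono hk.1 hkn hn.2
      diverges := fun t => h.finite_setOf_minMax_le hJ t
      multiplicity := fun t => h.rank_formEigenspace hJ hV t }
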